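/- Let $p\equiv 1 \pmod 6$ be a prime, let $\mathfrak p$ be a prime ideal of $\mathbb Z[\zeta_6]$ ($\zeta_6=e^{2\pi i/6}$) lying above $p$, and identify $\mathbb Z[\zeta_6]/\mathfrak p$ with $\mathbb F_p$. Let $\phi$ be the quadratic character of $\mathbb F_p^\times$ and let $\psi_{\mathfrak p}$ be the character of order $6$ of $(\mathbb Z[\zeta_6]/\mathfrak p)^\times\simeq\mathbb F_p^\times$ satisfying $\psi_{\mathfrak p}(x)\equiv x^{(p-1)/6}\pmod{\mathfrak p}$ for every $x\in\mathbb Z[\zeta_6]$. All multiplicative characters, including the trivial one, are extended to $\mathbb F_p$ by the value $0$ at $0$. For characters $A,B,C$ of $\mathbb F_p^\times$ put $J(A,B)=\sum_{x\in\mathbb F_p}A(x)B(1-x)$, $\binom AB=\frac{B(-1)}pJ(A,\overline B)$, and $${}_2F_1(A,B;C;x)=\frac p{p-1}\sum_{\eta}\binom{A\eta}{\eta}\binom{B\eta}{C\eta}\eta(x)\qquad(x\in\mathbb F_p),$$ where $\eta$ runs over all characters of $\mathbb F_p^\times$. Let $\chi$ be the Hecke character of $\mathbb Q(\zeta_6)$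 associated to the elliptic curve $E\colon y^2=x^3+1$ over $\mathbb Q$, that is, $L(E,s)=L(\chi,s)$, normalized so that $\chi(\mathfrak P)\in\mathfrak P$ for all nonzero prime ideals $\mathfrak P$ of $\mathbb Z[\zeta_6]$. Let $a\in\mathbb F_p$. If $a$ is not a square in $\mathbb F_p^\times$ (that is, there is no $b\in\mathbb F_p^\times$ with $a=b^2$), then $${}_2F_1(\phi\psi_{\mathfrak p}^2,\psi_{\mathfrak p}^2;\phi;a)={}_2F_1(\phi\psi_{\mathfrak p},\psi_{\mathfrak p};\phi;a)=0.$$ If $a=b^2$ with $b\in\mathbb F_p^\times$, then $${}_2F_1(\phi\psi_{\mathfrak p}^2,\psi_{\mathfrak p}^2;\phi;a)=-\frac{\phi(-1)}p\bigl(\psi_{\mathfrak p}^2(1+b)+\psi_{\mathfrak p}^2(1-b)\bigr)\chi(\mathfrak p),$$ $${}_2F_1(\phi\psi_{\mathfrak p},\psi_{\mathfrak p};\phi;a)=-\frac1p\bigl(\overline\psi_{\mathfrak p}^2(1+b)+\overline\psi_{\mathfrak p}^2(1-b)\bigr)\chi(\mathfrak p).$$ -/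

import Mathlib

open scoped NumberField

noncomputable section

/-! ### Gaussian hypergeometric functions over a finite field -/

section Hypergeometric

variable {F : Type*} [Field F] [Fintype F]

/-- Greene's binomial symbol `(A over B) = B(-1) / q * J(A, B⁻¹)` of two multiplicative characters
of the field `F` with `q` elements. Every character, the trivial one included, vanishes at `0`;
`jacobiSum A B` is `∑ x : F, A x * B (1 - x)`. -/
def greeneBinom (A B : MulChar F ℂ) : ℂ :=
  B (-1) / (Fintype.card F : ℂ) * jacobiSum A B⁻¹

/-- The hypergeometric function `₂F₁(A₀, A₁; B₁; x)` over the finite field `F` with `q` elements: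
`q / (q - 1) * ∑_χ (A₀χ over χ) (A₁χ over B₁χ) χ(x)`, the sum being over all (finitely many)
multiplicative characters `χ` of `F`. -/
def hypergeometric₂F₁ (A₀ A₁ B₁ : MulChar F ℂ) (x : F) : ℂ :=
  (Fintype.card F : ℂ) / ((Fintype.card F : ℂ) - 1) *
    ∑ᶠ χ : MulChar F ℂ, greeneBinom (A₀ * χ) χ * greeneBinom (A₁ * χ) (B₁ * χ) * χ x

end Hypergeometric

/-- The complex-valued quadratic character `φ` of `𝔽_p`. -/
def quadCharZMod (p : ℕ) [Fact p.Prime] : MulChar (ZMod p) ℂ :=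
  (quadraticChar (ZMod p)).ringHomComp (Int.castRingHom ℂ)

/-! ### Hecke characters of an imaginary quadratic field -/

section Hecke

variable {K : Type*} [Field K] [NumberField K]

/-- A Hecke character (Größencharakter, not necessarily unitary) of an imaginary quadratic field
`K`, viewed inside `ℂ` through `ι`, as a multiplicative function on the ideals of `𝓞 K`: for some
nonzero modulus `𝔪` it vanishes exactly on the ideals that are not coprime to `𝔪`, and on the
principal ideals `(α)` with `α ≡ 1 mod 𝔪` it is given by a continuous character of `ℂˣ`. -/
structure HeckeCharacter (ι : K →+* ℂ) where
  /-- the values on integral ideals -/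
  toFun : Ideal (𝓞 K) →*₀ ℂ
  /-- the modulus -/
  modulus : Ideal (𝓞 K)
  modulus_ne_bot : modulus ≠ ⊥
  /-- the component at infinity -/
  infinity : ℂˣ →ₜ* ℂˣ
  ne_zero_iff : ∀ I : Ideal (𝓞 K), I ≠ ⊥ → (toFun I ≠ 0 ↔ IsCoprime I modulus)
  principal : ∀ (α : 𝓞 K) (u : ℂˣ), (u : ℂ) = ι (α : K) → α - 1 ∈ modulus →
    toFun (Ideal.span {α}) = (infinity u : ℂ)

/-- The coefficients of `L(χ, s) = ∑_{I ≠ 0} χ(I) N(I)^(-s)` as a Dirichlet series: the `n`-th one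
is the sum of `χ(I)` over the (finitely many) ideals `I` of norm `n`. -/
def HeckeCharacter.coeff {ι : K →+* ℂ} (χ : HeckeCharacter ι) (n : ℕ) : ℂ :=
  ∑ᶠ I : {I : Ideal (𝓞 K) // Ideal.absNorm I = n}, χ.toFun I.1

/-- `χ` is associated to the elliptic curve `W` over `ℚ`: `L(W, s) = L(χ, s)`, that is, on some
right half-plane both Dirichlet series converge absolutely and their sums agree. -/
def HeckeCharacter.IsAssociatedTo {ι : K →+* ℂ} (χ : HeckeCharacter ι)
    (W : WeierstrassCurve ℚ) : Prop :=
  ∃ σ : ℝ, ∀ s : ℂ, σ < s.re →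
    LSeriesSummable (fun n ↦ (W.LFunction n : ℂ)) s ∧ LSeriesSummable χ.coeff s ∧
      W.LSeries s = LSeries χ.coeff s

/-- `χ(𝔓) ∈ 𝔓` for all nonzero primes `𝔓` of `𝓞 K`, where `K` is viewed inside `ℂ`. -/
def HeckeCharacter.ValuesInPrimes {ι : K →+* ℂ} (χ : HeckeCharacter ι) : Prop :=
  ∀ 𝔓 : Ideal (𝓞 K), 𝔓.IsPrime → 𝔓 ≠ ⊥ → ∃ z ∈ 𝔓, ι (z : K) = χ.toFun 𝔓

/-- `ψ` is the character `ψ_𝔭` of order `6` of `(𝓞 K / 𝔭)ˣ ≃ 𝔽_pˣ` with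
`ψ_𝔭(x) ≡ x^((p-1)/6) mod 𝔭` for all `x ∈ 𝓞 K`. Under the canonical identification the class
of `n : ℤ` in `𝔽_p` is the class mod `𝔭` of any `x : 𝓞 K` with `x ≡ n mod 𝔭`. The congruence
says that the complex number `ψ_𝔭(x)` is an element `z` of `𝓞 K` with
`z ≡ x^((p-1)/6) mod 𝔭`. -/
structure IsSexticResidueCharacter (ι : K →+* ℂ) (p : ℕ) (𝔭 : Ideal (𝓞 K))
    (ψ : MulChar (ZMod p) ℂ) : Prop where
  order : orderOf ψ = 6
  congr : ∀ (x : 𝓞 K) (n : ℤ), x - (n : 𝓞 K) ∈ 𝔭 →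
    ∃ z : 𝓞 K, ι (z : K) = ψ (n : ZMod p) ∧ z - x ^ ((p - 1) / 6) ∈ 𝔭

end Hecke

/-- The elliptic curve `y² = x³ + 1` over `ℚ`. -/
def curveE : WeierstrassCurve ℚ := ⟨0, 0, 0, 0, 1⟩

end

/-!
The proof has two independent halves.

*Character sums.* By the Hasse–Davenport formula for the quadratic character `φ`, the product of
the two Jacobi sums in the `η`-term of `₂F₁(φA, A; φ; a)` is a constant times the single Jacobi sum
`J(A²η², η⁻²)` (`jacobiSum_mul_jacobiSum_quadChar`). Orthogonality of characters then turns the sum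
over `η` into a sum of `A²(x)` over the solutions of `a x² = (1 - x)²`. There are none unless
`a = b²` with `b ≠ 0`, and then they are `x = (1 ± b)⁻¹`. This gives
`₂F₁(φA, A; φ; b²) = J(φA⁻¹, φ) / p * (A⁻²(1 + b) + A⁻²(1 - b))`
(`hypergeometric₂F₁_quadChar_sq`). For `A = ψ²` and `A = ψ` the Jacobi sum is `J(ψ², φ)`, up to the
sign `φ(-1)` in the first case, so that the claim is reduced to `χ(𝔭) = -J(ψ², φ)`.

*The Hecke character.* The curve has good reduction at `p`, and counting points on `y² = x³ + 1` by
characters gives `a_p = -(J + J̄)` for `J = J(ψ², φ)` (`curveE_LFunction_apply`,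
`card_points_eq_add_jacobiSum`). Since Mathlib's local factors refer to a chosen minimal equation
over the completion, this needs that the reductions of two equations with unit discriminants are
isomorphic (`WeierstrassCurve.exists_reduction_eq_variableChange`). The element `π = -J` of `𝓞 K`
lies in `𝔭`, because `ψ(x) ≡ x^((p-1)/6)` and power sums of small degree vanish in `𝔽_p`; as
`π π̄ = p`, it generates `𝔭`, and `𝔭 ≠ 𝔭̄`. Comparing the coefficients of `L(E, s)` and `L(χ, s)` at
`p` and `p²` gives `χ(𝔭) + χ(𝔭̄) = a_p` and `χ(𝔭) χ(𝔭̄) = p`. So `χ(𝔭)` is `π` or `π̄`, and the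
normalization `χ(𝔭) ∈ 𝔭` excludes `π̄`.
-/

/-! ### The quadratic character and Jacobi sums over `𝔽_p` -/

section CharacterSums

variable {p : ℕ} [Fact p.Prime]

lemma ringChar_zmod_ne_two (hp2 : p ≠ 2) : ringChar (ZMod p) ≠ 2 := by
  rwa [ZMod.ringChar_zmod_n]

lemma quadCharZMod_apply (a : ZMod p) :
    quadCharZMod p a = ((quadraticChar (ZMod p) a : ℤ) : ℂ) := rfl

lemma quadCharZMod_isQuadratic : (quadCharZMod p).IsQuadratic :=
  (quadraticChar_isQuadratic (ZMod p)).comp _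

lemma quadCharZMod_ne_one (hp2 : p ≠ 2) : quadCharZMod p ≠ 1 := by
  rw [quadCharZMod, Ne, MulChar.ringHomComp_eq_one_iff (Int.cast_injective)]
  exact quadraticChar_ne_one (ringChar_zmod_ne_two hp2)

lemma quadCharZMod_mul_self : quadCharZMod p * quadCharZMod p = 1 := by
  rw [← sq]; exact quadCharZMod_isQuadratic.sq_eq_one

lemma quadCharZMod_inv : (quadCharZMod p)⁻¹ = quadCharZMod p := quadCharZMod_isQuadratic.inv

/-- A nontrivial character of `𝔽_p` with trivial square is the quadratic character. -/
lemma eq_quadCharZMod_of_sq_eq_one (hp2 : p ≠ 2) {X : MulChar (ZMod p) ℂ} (hX : X ^ 2 = 1)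
    (hX1 : X ≠ 1) : X = quadCharZMod p := by
  obtain ⟨g, hg⟩ := IsCyclic.exists_generator (α := (ZMod p)ˣ)
  have key : ∀ Y : MulChar (ZMod p) ℂ, Y ^ 2 = 1 → Y ≠ 1 → Y g = -1 := by
    intro Y hY hY1
    have h1 : Y g ^ 2 = 1 := by
      rw [← MulChar.pow_apply_coe, hY, MulChar.one_apply_coe]
    rcases sq_eq_one_iff.mp h1 with h | h
    · exact absurd ((MulChar.eq_iff hg Y 1).mpr (by rw [h, MulChar.one_apply_coe])) hY1
    · exact h
  rw [MulChar.eq_iff hg, key X hX hX1, key _ _ (quadCharZMod_ne_one hp2)]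
  rw [sq, quadCharZMod_mul_self]

/-- An element `u` of `𝔽_p` has `1 + φ(u)` square roots. -/
lemma sum_comp_sq (hp2 : p ≠ 2) (f : ZMod p → ℂ) :
    ∑ y, f (y ^ 2) = ∑ u, (1 + quadCharZMod p u) * f u := by
  classical
  rw [← Finset.sum_fiberwise' Finset.univ (fun y : ZMod p ↦ y ^ 2) f]
  refine Finset.sum_congr rfl fun u _ ↦ ?_
  rw [Finset.sum_const, nsmul_eq_mul]
  congr 1
  have h := quadraticChar_card_sqrts (ringChar_zmod_ne_two hp2) u
  rw [quadCharZMod_apply, add_comm]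
  have h2 : (Finset.univ.filter fun y : ZMod p ↦ y ^ 2 = u) =
      {x : ZMod p | x ^ 2 = u}.toFinset := by
    ext; simp
  rw [h2]
  exact_mod_cast h

lemma four_ne_zero_zmod (hp2 : p ≠ 2) : (4 : ZMod p) ≠ 0 := by
  have h2 : (2 : ZMod p) ≠ 0 := Ring.two_ne_zero (ringChar_zmod_ne_two hp2)
  have : (4 : ZMod p) = 2 * 2 := by norm_num
  rw [this]; exact mul_ne_zero h2 h2

lemma quadCharZMod_four (hp2 : p ≠ 2) : quadCharZMod p 4 = 1 := by
  have h2 : (2 : ZMod p) ≠ 0 := Ring.two_ne_zero (ringChar_zmod_ne_two hp2)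
  rw [quadCharZMod_apply, show (4 : ZMod p) = 2 ^ 2 by norm_num, quadraticChar_sq_one' h2,
    Int.cast_one]

/-- The substitution `x = (1 + y) / 2` turns `x (1 - x)` into `(1 - y²) / 4`. -/
lemma jacobiSum_self (hp2 : p ≠ 2) {X : MulChar (ZMod p) ℂ} (hX : X ≠ 1) :
    jacobiSum X X = X⁻¹ 4 * jacobiSum X (quadCharZMod p) := by
  have h2 : (2 : ZMod p) ≠ 0 := Ring.two_ne_zero (ringChar_zmod_ne_two hp2)
  have e1 : jacobiSum X X = ∑ y : ZMod p, X⁻¹ 4 * X (1 - y ^ 2) := by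
    rw [jacobiSum]
    refine (Fintype.sum_bijective (fun y : ZMod p ↦ (1 + y) / 2) ?_ _ _ ?_).symm
    · exact (Equiv.bijective ((Equiv.addLeft (1 : ZMod p)).trans (Equiv.divRight₀ 2 h2)))
    · intro y
      rw [MulChar.inv_apply', ← map_mul, ← map_mul]
      congr 1
      have h4 := four_ne_zero_zmod hp2
      field_simp
      ring
  rw [e1, ← Finset.mul_sum, sum_comp_sq hp2 (fun u ↦ X (1 - u))]
  congr 1
  simp_rw [add_mul, one_mul]
  rw [Finset.sum_add_distrib, jacobiSum_comm X, jacobiSum]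
  have : ∑ x : ZMod p, X (1 - x) = 0 := by
    rw [← MulChar.sum_eq_zero_of_ne_one hX]
    exact (Equiv.subLeft (1 : ZMod p)).sum_comp (fun x ↦ X x)
  rw [this, zero_add]

lemma card_zmod_ne_zero : (Fintype.card (ZMod p) : ℂ) ≠ 0 := by
  rw [ZMod.card]; exact_mod_cast (Fact.out : p.Prime).ne_zero

lemma mul_inv_apply_of_ne_zero (X : MulChar (ZMod p) ℂ) {a : ZMod p} (ha : a ≠ 0) :
    X a * X⁻¹ a = 1 := by
  rw [← MulChar.mul_apply, mul_inv_cancel, MulChar.one_apply (isUnit_iff_ne_zero.mpr ha)]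

/-- The Hasse–Davenport product formula for the quadratic character. For `X² ≠ 1` it is
`jacobiSum_self` with the Jacobi sums written in terms of Gauss sums. -/
lemma gaussSum_mul_gaussSum_quadChar_mul (hp2 : p ≠ 2) (X : MulChar (ZMod p) ℂ)
    {e : AddChar (ZMod p) ℂ} (he : e.IsPrimitive) :
    gaussSum X e * gaussSum (quadCharZMod p * X) e =
      X⁻¹ 4 * gaussSum (quadCharZMod p) e * gaussSum (X ^ 2) e := by
  have h4 := four_ne_zero_zmod hp2
  by_cases hX1 : X = 1
  · subst hX1
    rw [inv_one, MulChar.one_apply (isUnit_iff_ne_zero.mpr h4), mul_one, one_pow]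
    ring
  by_cases hX2 : X ^ 2 = 1
  · have := eq_quadCharZMod_of_sq_eq_one hp2 hX2 hX1
    rw [hX2, this, quadCharZMod_mul_self, quadCharZMod_inv, quadCharZMod_four hp2, one_mul]
  have hXφ : X * quadCharZMod p ≠ 1 := by
    intro h
    apply hX2
    have : X = quadCharZMod p := by
      rw [← quadCharZMod_inv, eq_inv_iff_mul_eq_one, h]
    rw [this, sq, quadCharZMod_mul_self]
  have hg := gaussSum_ne_zero_of_nontrivial card_zmod_ne_zero hX1 he
  have e1 := jacobiSum_mul_nontrivial (χ := X) (φ := X) (by rwa [← sq]) e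
  have e2 := jacobiSum_mul_nontrivial hXφ e
  rw [jacobiSum_self hp2 hX1] at e1
  rw [← sq] at e1
  rw [mul_comm (quadCharZMod p) X]
  apply mul_left_cancel₀ hg
  linear_combination (-gaussSum (X * quadCharZMod p) e) * e1 +
    (X⁻¹ 4 * gaussSum (X ^ 2) e) * e2

lemma mulChar_neg_one_mul_self (X : MulChar (ZMod p) ℂ) : X (-1) * X (-1) = 1 := by
  rw [← map_mul]; simp

lemma quadChar_mul_sq (X : MulChar (ZMod p) ℂ) : (quadCharZMod p * X) ^ 2 = X ^ 2 := by
  rw [mul_pow, sq (quadCharZMod p), quadCharZMod_mul_self, one_mul]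

/-- The product of Jacobi sums attached to `₂F₁(φA, A; φ; ·)`, by means of the
Hasse–Davenport formula for `Aη` and `η⁻¹`. -/
lemma jacobiSum_mul_jacobiSum_quadChar (hp2 : p ≠ 2) {A : MulChar (ZMod p) ℂ} (hA : A ^ 2 ≠ 1)
    (η : MulChar (ZMod p) ℂ) :
    jacobiSum (quadCharZMod p * A * η) η⁻¹ * jacobiSum (A * η) (quadCharZMod p * η⁻¹) *
        jacobiSum (quadCharZMod p * A) (quadCharZMod p * A) =
      A⁻¹ 4 * quadCharZMod p (-1) * p * jacobiSum (A ^ 2 * η ^ 2) (η⁻¹ ^ 2) := by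
  have he := ZMod.isPrimitive_stdAddChar p
  set e : AddChar (ZMod p) ℂ := ZMod.stdAddChar
  have hφA : quadCharZMod p * A ≠ 1 := by
    intro h
    apply hA
    rw [← quadChar_mul_sq, h, one_pow]
  have hg := gaussSum_ne_zero_of_nontrivial card_zmod_ne_zero hφA he
  have hg2 := gaussSum_ne_zero_of_nontrivial card_zmod_ne_zero hA he
  have j1 := jacobiSum_mul_nontrivial (χ := quadCharZMod p * A * η) (φ := η⁻¹)
    (by rwa [mul_assoc, mul_inv_cancel, mul_one]) e
  have q2 : A * η * (quadCharZMod p * η⁻¹) = quadCharZMod p * A := by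
    rw [mul_mul_mul_comm, mul_inv_cancel, mul_one, mul_comm]
  have j2 := jacobiSum_mul_nontrivial (χ := A * η) (φ := quadCharZMod p * η⁻¹) (by rwa [q2]) e
  have j3 := jacobiSum_mul_nontrivial (χ := quadCharZMod p * A) (φ := quadCharZMod p * A)
    (by rwa [← sq, quadChar_mul_sq]) e
  have q4 : A ^ 2 * η ^ 2 * η⁻¹ ^ 2 = A ^ 2 := by
    rw [mul_assoc, ← mul_pow, mul_inv_cancel, one_pow, mul_one]
  have j4 := jacobiSum_mul_nontrivial (χ := A ^ 2 * η ^ 2) (φ := η⁻¹ ^ 2) (by rwa [q4]) e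
  rw [mul_assoc, mul_inv_cancel, mul_one] at j1
  rw [q2] at j2
  rw [← sq, quadChar_mul_sq] at j3
  rw [q4] at j4
  have d1 := gaussSum_mul_gaussSum_quadChar_mul hp2 (A * η) he
  have d2 := gaussSum_mul_gaussSum_quadChar_mul hp2 η⁻¹ he
  have s : gaussSum (quadCharZMod p) e ^ 2 = quadCharZMod p (-1) * p := by
    rw [gaussSum_sq (χ := quadCharZMod p) (quadCharZMod_ne_one hp2) quadCharZMod_isQuadratic he,
      ZMod.card]
  rw [mul_pow, mul_inv, MulChar.mul_apply, ← mul_assoc] at d1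
  rw [inv_inv] at d2
  have h4 := mul_inv_apply_of_ne_zero η (four_ne_zero_zmod hp2)
  -- clear the denominators `g(A²)` and `g(φA)²` of the Jacobi sums
  apply mul_left_cancel₀ hg2
  apply mul_left_cancel₀ (pow_ne_zero 2 hg)
  generalize gaussSum (quadCharZMod p * A) e = G at *
  generalize gaussSum (A ^ 2) e = G2 at *
  generalize gaussSum (quadCharZMod p) e = Gφ at *
  generalize gaussSum (quadCharZMod p * A * η) e = g1 at *
  generalize gaussSum η⁻¹ e = g2 at *
  generalize gaussSum (A * η) e = g3 at *
  generalize gaussSum (quadCharZMod p * η⁻¹) e = g4 at *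
  generalize gaussSum (A ^ 2 * η ^ 2) e = g5 at *
  generalize gaussSum (η⁻¹ ^ 2) e = g6 at *
  generalize jacobiSum (quadCharZMod p * A * η) η⁻¹ = J1 at *
  generalize jacobiSum (A * η) (quadCharZMod p * η⁻¹) = J2 at *
  generalize jacobiSum (quadCharZMod p * A) (quadCharZMod p * A) = J3 at *
  generalize jacobiSum (A ^ 2 * η ^ 2) (η⁻¹ ^ 2) = J4 at *
  generalize quadCharZMod p (-1) = f at *
  generalize A⁻¹ 4 = a at *
  generalize η⁻¹ 4 = h' at *
  generalize η 4 = h at *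
  linear_combination (G * J2 * G2 * J3) * j1 + (g1 * g2 * G2 * J3) * j2 +
    (g1 * g2 * g3 * g4) * j3 + (G ^ 2 * g2 * g4) * d1 + (G ^ 2 * a * h' * Gφ * g5) * d2 +
    (G ^ 2 * a * Gφ ^ 2 * g5 * g6) * h4 + (G ^ 2 * a * g5 * g6) * s - (G ^ 2 * a * f * p) * j4

/-! ### Evaluation of `₂F₁(φA, A; φ; ·)` -/

/-- For `c = 0` both sides vanish, since `X⁻¹ 0 = 0`. -/
lemma sum_mul_ite_mul_eq_one (X : MulChar (ZMod p) ℂ) (c : ZMod p) :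
    ∑ x, X x * (if x * c = 1 then 1 else 0) = X⁻¹ c := by
  rw [MulChar.inv_apply']
  rcases eq_or_ne c 0 with rfl | hc
  · simp [X.map_zero]
  · simp_rw [mul_eq_one_iff_eq_inv₀ hc]
    simp

/-- Orthogonality of characters evaluates the character sum that remains after the
product of two Jacobi sums has been collapsed to one. -/
lemma sum_jacobiSum_mul (A : MulChar (ZMod p) ℂ) (a : ZMod p) :
    ∑ η : DirichletCharacter ℂ p, jacobiSum (A ^ 2 * η ^ 2) (η⁻¹ ^ 2) * η a =
      ((p : ℂ) - 1) * ∑ x, (A ^ 2) x * (if (x * (1 - x)⁻¹) ^ 2 * a = 1 then 1 else 0) := by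
  simp_rw [jacobiSum, Finset.sum_mul]
  rw [Finset.sum_comm, Finset.mul_sum]
  refine Finset.sum_congr rfl fun x _ ↦ ?_
  have h : ∀ η : DirichletCharacter ℂ p,
      (A ^ 2 * η ^ 2 : MulChar (ZMod p) ℂ) x * (η⁻¹ ^ 2) (1 - x) * η a =
        (A ^ 2) x * η ((x * (1 - x)⁻¹) ^ 2 * a) := by
    intro η
    rw [MulChar.mul_apply, MulChar.pow_apply' η two_ne_zero, MulChar.pow_apply' η⁻¹ two_ne_zero,
      MulChar.inv_apply', map_mul, map_pow, map_mul]
    ring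
  rw [Finset.sum_congr rfl fun η _ ↦ h η, ← Finset.mul_sum, DirichletCharacter.sum_characters_eq,
    Nat.totient_prime Fact.out, Nat.cast_sub (Fact.out : p.Prime).one_le]
  split_ifs <;> simp [mul_comm]

/-- `₂F₁(φA, A; φ; a)` as a sum over the solutions of `a x² = (1 - x)²`. The inverse `(1 - x)⁻¹` is
`0` for `x = 1`, so this value of `x` does not contribute. -/
lemma hypergeometric₂F₁_quadChar (hp2 : p ≠ 2) {A : MulChar (ZMod p) ℂ} (hA : A ^ 2 ≠ 1)
    (a : ZMod p) :
    hypergeometric₂F₁ (quadCharZMod p * A) A (quadCharZMod p) a *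
        jacobiSum (quadCharZMod p * A) (quadCharZMod p * A) =
      A⁻¹ 4 * ∑ x, (A ^ 2) x * (if (x * (1 - x)⁻¹) ^ 2 * a = 1 then 1 else 0) := by
  have hp0 : (p : ℂ) ≠ 0 := by exact_mod_cast (Fact.out : p.Prime).ne_zero
  have hp1 : (p : ℂ) - 1 ≠ 0 := by
    rw [sub_ne_zero]; exact_mod_cast (Fact.out : p.Prime).ne_one
  rw [hypergeometric₂F₁, ZMod.card]
  have hfs : ∀ f : MulChar (ZMod p) ℂ → ℂ, ∑ᶠ η, f η = ∑ η : DirichletCharacter ℂ p, f η :=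
    fun f ↦ finsum_eq_sum_of_fintype (α := DirichletCharacter ℂ p) f
  rw [hfs, mul_assoc, Finset.sum_mul]
  have h : ∀ η : DirichletCharacter ℂ p,
      greeneBinom (quadCharZMod p * A * η) η * greeneBinom (A * η) (quadCharZMod p * η) * η a *
        jacobiSum (quadCharZMod p * A) (quadCharZMod p * A) =
      (A⁻¹ 4 / p) * (jacobiSum (A ^ 2 * η ^ 2) (η⁻¹ ^ 2) * η a) := by
    intro η
    have k := jacobiSum_mul_jacobiSum_quadChar hp2 hA η
    have h1 := mulChar_neg_one_mul_self η
    have h2 := mulChar_neg_one_mul_self (quadCharZMod p)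
    rw [greeneBinom, greeneBinom, ZMod.card, mul_inv, quadCharZMod_inv, MulChar.mul_apply]
    field_simp
    linear_combination (η a * (η (-1)) ^ 2 * quadCharZMod p (-1)) * k +
      (A⁻¹ 4 * p * jacobiSum (A ^ 2 * η ^ 2) (η⁻¹ ^ 2) * η a * (η (-1)) ^ 2) * h2 +
      (A⁻¹ 4 * p * jacobiSum (A ^ 2 * η ^ 2) (η⁻¹ ^ 2) * η a) * h1
  rw [Finset.sum_congr rfl fun η _ ↦ h η, ← Finset.mul_sum, sum_jacobiSum_mul]
  generalize ∑ x, (A ^ 2) x * (if (x * (1 - x)⁻¹) ^ 2 * a = 1 then (1 : ℂ) else 0) = S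
  field_simp

lemma jacobiSum_quadChar_mul_self_mul_inv {A : MulChar (ZMod p) ℂ}
    (hA : A ^ 2 ≠ 1) :
    jacobiSum (quadCharZMod p * A) (quadCharZMod p * A) *
      jacobiSum (quadCharZMod p * A⁻¹) (quadCharZMod p * A⁻¹) = p := by
  have hφA : quadCharZMod p * A ≠ 1 := by
    intro h
    apply hA
    rw [← quadChar_mul_sq, h, one_pow]
  have h := jacobiSum_mul_jacobiSum_inv (F := ZMod p) (F' := ℂ) (χ := quadCharZMod p * A)
    (φ := quadCharZMod p * A) (by
      rw [ZMod.ringChar_zmod_n, ringChar.eq_zero]; exact (Fact.out : p.Prime).ne_zero.symm)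
    hφA hφA (by rwa [← sq, quadChar_mul_sq])
  rw [ZMod.card, mul_inv, quadCharZMod_inv] at h
  exact h

lemma quadChar_mul_inv_ne_one {A : MulChar (ZMod p) ℂ} (hA : A ^ 2 ≠ 1) :
    quadCharZMod p * A⁻¹ ≠ 1 := by
  intro h
  apply hA
  rw [← quadCharZMod_inv, ← mul_inv, inv_eq_one] at h
  rw [← quadChar_mul_sq, h, one_pow]

/-- `₂F₁(φA, A; φ; a)` vanishes unless `a` is a nonzero square. -/
theorem hypergeometric₂F₁_quadChar_eq_zero (hp2 : p ≠ 2) {A : MulChar (ZMod p) ℂ}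
    (hA : A ^ 2 ≠ 1) {a : ZMod p} (ha : ¬ ∃ b : ZMod p, b ≠ 0 ∧ a = b ^ 2) :
    hypergeometric₂F₁ (quadCharZMod p * A) A (quadCharZMod p) a = 0 := by
  have hJ : jacobiSum (quadCharZMod p * A) (quadCharZMod p * A) ≠ 0 := by
    apply left_ne_zero_of_mul
    rw [jacobiSum_quadChar_mul_self_mul_inv hA]
    exact_mod_cast (Fact.out : p.Prime).ne_zero
  refine (mul_eq_zero.mp ?_).resolve_right hJ
  rw [hypergeometric₂F₁_quadChar hp2 hA, Finset.sum_eq_zero, mul_zero]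
  intro x _
  rw [if_neg, mul_zero]
  intro h
  have h0 : x * (1 - x)⁻¹ ≠ 0 := by
    intro h0
    rw [h0] at h
    simp at h
  refine ha ⟨(x * (1 - x)⁻¹)⁻¹, inv_ne_zero h0, ?_⟩
  rw [inv_pow]
  exact eq_inv_of_mul_eq_one_right h

/-- The evaluation of `₂F₁(φA, A; φ; b²)`, a finite field analogue of
`₂F₁(α, α + 1/2; 1/2; z²) = ((1 + z)^(-2α) + (1 - z)^(-2α)) / 2`. -/
theorem hypergeometric₂F₁_quadChar_sq (hp2 : p ≠ 2) {A : MulChar (ZMod p) ℂ}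
    (hA : A ^ 2 ≠ 1) {b : ZMod p} (hb : b ≠ 0) :
    hypergeometric₂F₁ (quadCharZMod p * A) A (quadCharZMod p) (b ^ 2) =
      1 / p * jacobiSum (quadCharZMod p * A⁻¹) (quadCharZMod p) *
        ((A ^ 2)⁻¹ (1 + b) + (A ^ 2)⁻¹ (1 - b)) := by
  have h2 : (2 : ZMod p) ≠ 0 := Ring.two_ne_zero (ringChar_zmod_ne_two hp2)
  have hp0 : (p : ℂ) ≠ 0 := by exact_mod_cast (Fact.out : p.Prime).ne_zero
  have hJ := jacobiSum_quadChar_mul_self_mul_inv hA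
  -- the solutions of `b² x² = (1 - x)²`, which are distinct because `2b ≠ 0`
  have key : ∀ x : ZMod p, (if (x * (1 - x)⁻¹) ^ 2 * b ^ 2 = 1 then (1 : ℂ) else 0) =
      (if x * (1 + b) = 1 then 1 else 0) + (if x * (1 - b) = 1 then 1 else 0) := by
    intro x
    by_cases h1 : x * (1 + b) = 1
    · have h1' : ¬ x * (1 - b) = 1 := by
        intro h
        have e : x * (2 * b) = 0 := by linear_combination h1 - h
        rcases mul_eq_zero.mp e with e | e
        · rw [e, zero_mul] at h1; exact zero_ne_one h1
        · exact (mul_ne_zero h2 hb) e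
      have e : 1 - x = x * b := by linear_combination -h1
      have hx : x ≠ 0 := by rintro rfl; simp at h1
      rw [if_pos h1, if_neg h1', if_pos, add_zero]
      rw [e]; field_simp
    · rw [if_neg h1]
      by_cases h3 : x * (1 - b) = 1
      · have e : 1 - x = - (x * b) := by linear_combination -h3
        have hx : x ≠ 0 := by rintro rfl; simp at h3
        rw [if_pos h3, if_pos, zero_add]
        rw [e]; field_simp
      · rw [if_neg h3, if_neg, add_zero]
        intro h
        rw [← mul_pow, sq_eq_one_iff] at h
        have hx : 1 - x ≠ 0 := by
          intro hx; rw [hx] at h; simp at h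
        rcases h with h | h
        · field_simp at h
          exact h1 (by linear_combination h)
        · field_simp at h
          exact h3 (by linear_combination -h)
  have h := hypergeometric₂F₁_quadChar hp2 hA (b ^ 2)
  simp_rw [key, mul_add ((A ^ 2) _), Finset.sum_add_distrib, sum_mul_ite_mul_eq_one] at h
  have hs := jacobiSum_self hp2 (quadChar_mul_inv_ne_one hA)
  have hJ0 := left_ne_zero_of_mul (hJ.trans_ne hp0)
  apply mul_right_cancel₀ hJ0
  rw [h]
  rw [hs, mul_inv, inv_inv, quadCharZMod_inv, MulChar.mul_apply, quadCharZMod_four hp2,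
    one_mul] at hJ
  field_simp
  rw [← hJ]
  linear_combination (jacobiSum (quadCharZMod p * A⁻¹) (quadCharZMod p) *
    jacobiSum (quadCharZMod p * A) (quadCharZMod p * A) *
    ((A ^ 2)⁻¹ (1 + b) + (A ^ 2)⁻¹ (1 - b))) *
    mul_inv_apply_of_ne_zero A (four_ne_zero_zmod hp2)

end CharacterSums

/-! ### The hypergeometric values for characters of order six -/

section SexticCharacters

variable {p : ℕ} [Fact p.Prime]

/-- The substitution `x ↦ x⁻¹` in a Jacobi sum. -/
lemma jacobiSum_eq_apply_neg_one_mul (X Y : MulChar (ZMod p) ℂ) :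
    jacobiSum X Y = Y (-1) * jacobiSum (X⁻¹ * Y⁻¹) Y := by
  rw [jacobiSum, jacobiSum, Finset.mul_sum]
  refine Fintype.sum_bijective (fun x ↦ x⁻¹) inv_involutive.bijective _ _ fun x ↦ ?_
  rcases eq_or_ne x 0 with rfl | hx
  · simp [X.map_zero, (X⁻¹ * Y⁻¹).map_zero]
  · rw [MulChar.mul_apply, MulChar.inv_apply', MulChar.inv_apply', inv_inv]
    have : (1 - x : ZMod p) = -1 * (x * (1 - x⁻¹)) := by field_simp; ring
    rw [this, map_mul, map_mul]
    ring

lemma quadCharZMod_eq_pow_three (hp2 : p ≠ 2) {ψ : MulChar (ZMod p) ℂ} (hψ : orderOf ψ = 6) :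
    quadCharZMod p = ψ ^ 3 := by
  refine (eq_quadCharZMod_of_sq_eq_one hp2 ?_ ?_).symm
  · rw [← pow_mul]; exact orderOf_dvd_iff_pow_eq_one.mp (by rw [hψ])
  · exact pow_ne_one_of_lt_orderOf three_ne_zero (by omega)

theorem hypergeometric₂F₁_sextic_sq (hp2 : p ≠ 2) {ψ : MulChar (ZMod p) ℂ} (hψ : orderOf ψ = 6)
    {b : ZMod p} (hb : b ≠ 0) :
    hypergeometric₂F₁ (quadCharZMod p * ψ ^ 2) (ψ ^ 2) (quadCharZMod p) (b ^ 2) =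
      quadCharZMod p (-1) / p * ((ψ ^ 2) (1 + b) + (ψ ^ 2) (1 - b)) *
        jacobiSum (ψ ^ 2) (quadCharZMod p) := by
  have h6 : ψ ^ 6 = 1 := by rw [← hψ, pow_orderOf_eq_one]
  have e1 : ((ψ ^ 2) ^ 2)⁻¹ = ψ ^ 2 := by
    rw [inv_eq_iff_mul_eq_one, ← pow_mul, ← pow_add, h6]
  have hφ := quadCharZMod_eq_pow_three hp2 hψ
  have e2 : quadCharZMod p * (ψ ^ 2)⁻¹ = ψ := by
    rw [hφ, mul_inv_eq_iff_eq_mul, ← pow_succ']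
  have e3 : ψ⁻¹ * (quadCharZMod p)⁻¹ = ψ ^ 2 := by
    rw [hφ, ← mul_inv, inv_eq_iff_mul_eq_one, ← pow_succ', ← pow_add, h6]
  rw [hypergeometric₂F₁_quadChar_sq hp2 (pow_ne_one_of_lt_orderOf (n := 2 * 2) (by omega)
    (by omega) ∘ (pow_mul ψ 2 2).trans) hb, e1, e2, jacobiSum_eq_apply_neg_one_mul, e3]
  ring

theorem hypergeometric₂F₁_sextic (hp2 : p ≠ 2) {ψ : MulChar (ZMod p) ℂ} (hψ : orderOf ψ = 6)
    {b : ZMod p} (hb : b ≠ 0) :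
    hypergeometric₂F₁ (quadCharZMod p * ψ) ψ (quadCharZMod p) (b ^ 2) =
      1 / p * ((ψ⁻¹ ^ 2) (1 + b) + (ψ⁻¹ ^ 2) (1 - b)) *
        jacobiSum (ψ ^ 2) (quadCharZMod p) := by
  have e2 : quadCharZMod p * ψ⁻¹ = ψ ^ 2 := by
    rw [quadCharZMod_eq_pow_three hp2 hψ, mul_inv_eq_iff_eq_mul, ← pow_succ]
  rw [hypergeometric₂F₁_quadChar_sq hp2 (pow_ne_one_of_lt_orderOf two_ne_zero (by omega)) hb, e2,
    inv_pow]
  ring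

/-! ### The affine points of `y² = x³ + 1` over `𝔽_p` -/

/-- The character group of `𝔽_pˣ` is cyclic, so it has only three elements of order dividing `3`. -/
lemma mulChar_pow_three_eq_one {ω : MulChar (ZMod p) ℂ} (hω : orderOf ω = 3)
    {η : MulChar (ZMod p) ℂ} : η ^ 3 = 1 ↔ η = 1 ∨ η = ω ∨ η = ω ^ 2 := by
  classical
  let _ : Fintype (MulChar (ZMod p) ℂ) := DirichletCharacter.fintype (R := ℂ) (n := p)
  have : IsCyclic (MulChar (ZMod p) ℂ) :=
    isCyclic_of_injective (DirichletCharacter.mulEquiv_units ℂ p).some.toMonoidHom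
      (DirichletCharacter.mulEquiv_units ℂ p).some.injective
  have h3 : ω ^ 3 = 1 := by rw [← hω, pow_orderOf_eq_one]
  have h1 : ω ≠ 1 := by rintro rfl; simp at hω
  have h2 : ω ^ 2 ≠ 1 := pow_ne_one_of_lt_orderOf two_ne_zero (by omega)
  have h12 : ω ^ 2 ≠ ω := by rwa [sq, Ne, mul_eq_left]
  have hsub : ({1, ω, ω ^ 2} : Finset (MulChar (ZMod p) ℂ)) ⊆
      Finset.univ.filter fun η ↦ η ^ 3 = 1 := by
    intro η hη
    simp only [Finset.mem_insert, Finset.mem_singleton] at hη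
    rw [Finset.mem_filter]
    refine ⟨Finset.mem_univ _, ?_⟩
    rcases hη with rfl | rfl | rfl
    · simp
    · exact h3
    · rw [← pow_mul, mul_comm, pow_mul, h3, one_pow]
  have hcard : ({1, ω, ω ^ 2} : Finset (MulChar (ZMod p) ℂ)).card = 3 :=
    Finset.card_eq_three.mpr ⟨_, _, _, h1.symm, h2.symm, h12.symm, rfl⟩
  have := Finset.eq_of_subset_of_card_le hsub
    ((IsCyclic.card_pow_eq_one_le three_pos).trans hcard.ge)
  have h := Finset.ext_iff.mp this η
  simpa using h.symm

/-- The number of cube roots of `u` is `1 + ω(u) + ω²(u)`, for a cubic character `ω`; by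
orthogonality it is the sum of `η(u⁻¹)` over the characters `η` with `η³ = 1`. -/
lemma sum_comp_cube {ω : MulChar (ZMod p) ℂ} (hω : orderOf ω = 3) (f : ZMod p → ℂ) :
    ∑ x, f (x ^ 3) = ∑ u, (1 + ω u + (ω ^ 2) u) * f u := by
  classical
  have hp1 : ((p : ℂ) - 1) ≠ 0 := by
    rw [sub_ne_zero]; exact_mod_cast (Fact.out : p.Prime).ne_one
  rw [← Finset.sum_fiberwise' Finset.univ (fun y : ZMod p ↦ y ^ 3) f]
  refine Finset.sum_congr rfl fun u _ ↦ ?_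
  rw [Finset.sum_const, nsmul_eq_mul]
  congr 1
  rcases eq_or_ne u 0 with rfl | hu
  · simp [ω.map_zero, (ω ^ 2).map_zero, Finset.filter_eq']
  let _ : Fintype (MulChar (ZMod p) ℂ) := DirichletCharacter.fintype (R := ℂ) (n := p)
  have hsum : ∀ η : MulChar (ZMod p) ℂ, ∑ x, (η ^ 3) x = if η ^ 3 = 1 then (p : ℂ) - 1 else 0 := by
    intro η
    split_ifs with h
    · rw [h, MulChar.sum_one_eq_card_units, ZMod.card_units, Nat.cast_sub
        (Fact.out : p.Prime).one_le, Nat.cast_one]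
    · exact MulChar.sum_eq_zero_of_ne_one h
  have h1 : ∑ x : ZMod p, ∑ η : MulChar (ZMod p) ℂ, η (x ^ 3 * u⁻¹) =
      ((p : ℂ) - 1) * (Finset.univ.filter fun y : ZMod p ↦ y ^ 3 = u).card := by
    have : ∀ x : ZMod p, ∑ η : MulChar (ZMod p) ℂ, η (x ^ 3 * u⁻¹) =
        if x ^ 3 = u then (p : ℂ) - 1 else 0 := by
      intro x
      refine (DirichletCharacter.sum_characters_eq ℂ (x ^ 3 * u⁻¹)).trans ?_
      rw [Nat.totient_prime Fact.out, Nat.cast_sub (Fact.out : p.Prime).one_le, Nat.cast_one]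
      simp_rw [mul_inv_eq_one₀ hu]
    simp_rw [this, ← Finset.sum_filter]
    rw [Finset.sum_const, nsmul_eq_mul, mul_comm]
  have h2 : ∑ x : ZMod p, ∑ η : MulChar (ZMod p) ℂ, η (x ^ 3 * u⁻¹) =
      ((p : ℂ) - 1) * ∑ η ∈ Finset.univ.filter (fun η : MulChar (ZMod p) ℂ ↦ η ^ 3 = 1),
        η u⁻¹ := by
    rw [Finset.sum_comm, Finset.mul_sum, Finset.sum_filter]
    refine Finset.sum_congr rfl fun η _ ↦ ?_
    simp_rw [map_mul, map_pow, ← MulChar.pow_apply' η three_ne_zero]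
    rw [← Finset.sum_mul, hsum]
    split_ifs <;> simp
  have h3 : Finset.univ.filter (fun η : MulChar (ZMod p) ℂ ↦ η ^ 3 = 1) = {1, ω, ω ^ 2} := by
    ext η; simp [mulChar_pow_three_eq_one hω]
  have hω3 : ω ^ 3 = 1 := by rw [← hω, pow_orderOf_eq_one]
  have g1 : ω ≠ 1 := by rintro rfl; simp at hω
  have g2 : ω ^ 2 ≠ 1 := pow_ne_one_of_lt_orderOf two_ne_zero (by omega)
  have g12 : ω ^ 2 ≠ ω := by rwa [sq, Ne, mul_eq_left]
  have i1 : ω u⁻¹ = (ω ^ 2) u := by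
    rw [← MulChar.inv_apply']; congr 1; rw [inv_eq_iff_mul_eq_one, ← pow_succ', hω3]
  have i2 : (ω ^ 2) u⁻¹ = ω u := by
    rw [← MulChar.inv_apply']; congr 1; rw [inv_eq_iff_mul_eq_one, ← pow_succ, hω3]
  apply mul_left_cancel₀ hp1
  rw [← h1, h2, h3, Finset.sum_insert (by simp [g1.symm, g2.symm]), Finset.sum_pair g12.symm,
    i1, i2, MulChar.one_apply (isUnit_iff_ne_zero.mpr (inv_ne_zero hu))]
  ring

/-- The affine points of `y² = x³ + 1` over `𝔽_p` are counted by Jacobi sums. -/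
theorem card_points_eq_add_jacobiSum (hp2 : p ≠ 2) {ω : MulChar (ZMod p) ℂ}
    (hω : orderOf ω = 3) :
    (Nat.card {P : ZMod p × ZMod p // P.2 ^ 2 = P.1 ^ 3 + 1} : ℂ) =
      p + jacobiSum ω (quadCharZMod p) + jacobiSum (ω ^ 2) (quadCharZMod p) := by
  classical
  have hω3 : ω ^ 3 = 1 := by rw [← hω, pow_orderOf_eq_one]
  have hneg : ω (-1) = 1 := by
    have h := mulChar_neg_one_mul_self ω
    have h' : ω (-1) ^ 3 = 1 := by rw [← MulChar.pow_apply' ω three_ne_zero, hω3]; exact MulChar.one_apply isUnit_one.neg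
    linear_combination h' - ω (-1) * h
  have hneg2 : (ω ^ 2) (-1) = 1 := by rw [MulChar.pow_apply' ω two_ne_zero, hneg, one_pow]
  have hJ : ∀ X : MulChar (ZMod p) ℂ, X (-1) = 1 →
      ∑ u, X u * quadCharZMod p (u + 1) = jacobiSum X (quadCharZMod p) := by
    intro X hX
    rw [jacobiSum, ← Equiv.sum_comp (Equiv.neg (ZMod p)) fun x ↦ X x * _]
    refine Finset.sum_congr rfl fun u _ ↦ ?_
    rw [Equiv.neg_apply, neg_eq_neg_one_mul, map_mul, hX]
    ring_nf
  have h0 : ∑ u : ZMod p, quadCharZMod p (u + 1) = 0 :=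
    (Equiv.sum_comp (Equiv.addRight (1 : ZMod p)) (fun x ↦ quadCharZMod p x)).trans
      (MulChar.sum_eq_zero_of_ne_one (quadCharZMod_ne_one hp2))
  have h1 : (Nat.card {P : ZMod p × ZMod p // P.2 ^ 2 = P.1 ^ 3 + 1} : ℂ) =
      ∑ x : ZMod p, ∑ y : ZMod p, if y ^ 2 = x ^ 3 + 1 then 1 else 0 := by
    rw [Nat.card_eq_fintype_card, Fintype.card_subtype, ← Fintype.sum_prod_type', Finset.sum_boole]
  have h2 : ∀ x : ZMod p, (∑ y : ZMod p, if y ^ 2 = x ^ 3 + 1 then (1 : ℂ) else 0) =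
      1 + quadCharZMod p (x ^ 3 + 1) := by
    intro x
    rw [sum_comp_sq hp2 fun u ↦ if u = x ^ 3 + 1 then (1 : ℂ) else 0]
    simp
  rw [h1, Finset.sum_congr rfl fun x _ ↦ h2 x, Finset.sum_add_distrib,
    sum_comp_cube hω fun u ↦ quadCharZMod p (u + 1)]
  simp_rw [add_mul, one_mul]
  rw [Finset.sum_add_distrib, Finset.sum_add_distrib, h0, hJ _ hneg, hJ _ hneg2]
  simp
  ring

end SexticCharacters

/-! ### Good reduction and point counts of Weierstrass curves -/

namespace WeierstrassCurve

section PointCount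

variable {k : Type*} [Field k]

lemma card_point_eq_card_equation_add_one [Finite k] {W : WeierstrassCurve k} (hΔ : W.Δ ≠ 0) :
    Nat.card W.toAffine.Point = Nat.card {P : k × k // W.toAffine.Equation P.1 P.2} + 1 := by
  rw [← Finite.card_option]
  exact Nat.card_congr ((Affine.nonsingularPointEquiv W.toAffine).trans
    (Equiv.optionCongr (Equiv.subtypeEquivRight fun P ↦
      (W.toAffine.equation_iff_nonsingular_of_Δ_ne_zero hΔ).symm)))

lemma variableChange_equation_iff (W : WeierstrassCurve k) (C : VariableChange k) (x y : k) :
    (C • W).toAffine.Equation x y ↔ W.toAffine.Equation (C.u ^ 2 * x + C.r)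
      (C.u ^ 3 * y + C.u ^ 2 * C.s * x + C.t) := by
  rw [Affine.equation_iff', Affine.equation_iff', variableChange_def]
  have hu : (C.u : k) ≠ 0 := C.u.ne_zero
  rw [← mul_eq_zero_iff_left (pow_ne_zero 6 hu)]
  simp only [Units.val_inv_eq_inv_val]
  apply Eq.congr _ rfl
  field_simp
  ring

/-- The affine points of `C • W` and `W` correspond under
`(x, y) ↦ (u²x + r, u³y + u²sx + t)`. -/
def variableChangePointEquiv (W : WeierstrassCurve k) (C : VariableChange k) :
    {P : k × k // (C • W).toAffine.Equation P.1 P.2} ≃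
      {P : k × k // W.toAffine.Equation P.1 P.2} where
  toFun P := ⟨(C.u ^ 2 * P.1.1 + C.r, C.u ^ 3 * P.1.2 + C.u ^ 2 * C.s * P.1.1 + C.t),
    (variableChange_equation_iff W C _ _).mp P.2⟩
  invFun P := ⟨((P.1.1 - C.r) / C.u ^ 2, (P.1.2 - C.s * (P.1.1 - C.r) - C.t) / C.u ^ 3), by
    have hu : (C.u : k) ≠ 0 := C.u.ne_zero
    rw [variableChange_equation_iff]
    convert P.2 using 1 <;> (dsimp only; field_simp; ring)⟩
  left_inv P := by
    have hu : (C.u : k) ≠ 0 := C.u.ne_zero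
    ext <;> (dsimp only; field_simp; try ring)
  right_inv P := by
    have hu : (C.u : k) ≠ 0 := C.u.ne_zero
    ext <;> (dsimp only; field_simp; try ring)

end PointCount

section GoodReduction

open IsDiscreteValuationRing IsLocalRing IsDedekindDomain.HeightOneSpectrum

variable {R : Type*} [CommRing R] [IsDomain R] [IsDiscreteValuationRing R]
variable {K : Type*} [Field K] [Algebra R K] [IsFractionRing R K]

lemma valuation_algebraMap_eq_one {x : R} (hx : IsUnit x) :
    valuation K (maximalIdeal R) (algebraMap R K x) = 1 :=
  (valuation_eq_one_iff_notMem _).mpr fun h ↦ (IsLocalRing.mem_maximalIdeal x).mp h hx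

lemma exists_units_algebraMap_eq {x : K} (hx : valuation K (maximalIdeal R) x = 1) :
    ∃ u : Rˣ, algebraMap R K u = x := by
  obtain ⟨r, rfl⟩ := exists_lift_of_le_one (A := R) hx.le
  have hr : IsUnit r := by
    by_contra h
    exact (valuation_eq_one_iff_notMem (K := K) _).mp hx ((IsLocalRing.mem_maximalIdeal r).mpr h)
  exact ⟨hr.unit, rfl⟩

/-- If an integral equation has unit discriminant, so has every minimal equation. -/
lemma minimal_hasGoodReduction {W : WeierstrassCurve R} (hΔ : IsUnit W.Δ) :
    ((W.baseChange K).minimal R).HasGoodReduction R := by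
  refine ⟨?_⟩
  set C := ((W.baseChange K).exists_isMinimal R).choose with hC
  have hmin : IsMinimal R (C • W.baseChange K) := ((W.baseChange K).exists_isMinimal R).choose_spec
  change valuation K (maximalIdeal R) (C • W.baseChange K).Δ = 1
  have hint : IsIntegral R (C⁻¹ • C • W.baseChange K) := by
    rw [inv_smul_smul]; exact ⟨W, rfl⟩
  have hval : valuation K (maximalIdeal R) (C⁻¹ • C • W.baseChange K).Δ = 1 := by
    rw [inv_smul_smul, baseChange, map_Δ]
    exact valuation_algebraMap_eq_one hΔ
  have hle : valuation_Δ_aux R ((1 : VariableChange K) • C • W.baseChange K) ≤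
      valuation_Δ_aux R (C⁻¹ • C • W.baseChange K) := by
    rw [← Subtype.coe_le_coe, valuation_Δ_aux_eq_of_isIntegral R (C⁻¹ • C • W.baseChange K), hval]
    exact (valuation_Δ_aux R _).2
  have h := hmin.val_Δ_maximal.2 hint hle
  dsimp only at h
  rw [one_smul, ← Subtype.coe_le_coe, valuation_Δ_aux_eq_of_isIntegral, hval,
    valuation_Δ_aux_eq_of_isIntegral] at h
  refine le_antisymm ?_ h
  rw [← valuation_Δ_aux_eq_of_isIntegral]
  exact (valuation_Δ_aux R _).2

/-- When `6` is a unit, a change of variables between two integral equations with unit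
discriminants is itself integral, so that the two reductions are isomorphic. -/
lemma exists_reduction_eq_variableChange (h6 : IsUnit (6 : R)) {W : WeierstrassCurve R}
    (hΔ : IsUnit W.Δ) {C : VariableChange K} [hM : IsMinimal R (C • W.baseChange K)]
    (hgood : valuation K (maximalIdeal R) (C • W.baseChange K).Δ = 1) :
    ∃ C₀ : VariableChange (ResidueField R),
      (C • W.baseChange K).reduction R = C₀ • W.map (residue R) := by
  have h2 : IsUnit (2 : R) := isUnit_of_dvd_unit ⟨3, by norm_num⟩ h6
  have h3 : IsUnit (3 : R) := isUnit_of_dvd_unit ⟨2, by norm_num⟩ h6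
  have hu : valuation K (maximalIdeal R) (C.u : K) = 1 := by
    rw [variableChange_Δ, map_mul, baseChange, map_Δ, valuation_algebraMap_eq_one hΔ, mul_one,
      map_pow, Units.val_inv_eq_inv_val, map_inv₀, inv_pow, inv_eq_one] at hgood
    exact (pow_eq_one_iff.mp hgood).resolve_right (by norm_num)
  obtain ⟨u, hu⟩ := exists_units_algebraMap_eq hu
  obtain ⟨v2, hv2⟩ := h2.exists_right_inv
  obtain ⟨v3, hv3⟩ := h3.exists_right_inv
  set I := integralModel R (C • W.baseChange K) with hI
  set f := algebraMap R K with hf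
  have hIM : I.map f = C • W.baseChange K := baseChange_integralModel_eq R _
  have hv2' : 2 * f v2 = 1 := by rw [← map_one f, ← hv2, map_mul, map_ofNat]
  have hv3' : 3 * f v3 = 1 := by rw [← map_one f, ← hv3, map_mul, map_ofNat]
  have hu0 : (C.u : K) ≠ 0 := C.u.ne_zero
  have e1 := integralModel_a₁_eq R (C • W.baseChange K)
  have e2 := integralModel_a₂_eq R (C • W.baseChange K)
  have e3 := integralModel_a₃_eq R (C • W.baseChange K)
  rw [variableChange_a₁, ← hI, ← hf] at e1
  rw [variableChange_a₂, ← hI, ← hf] at e2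
  rw [variableChange_a₃, ← hI, ← hf] at e3
  have b1 : (W.baseChange K).a₁ = f W.a₁ := rfl
  have b2 : (W.baseChange K).a₂ = f W.a₂ := rfl
  have b3 : (W.baseChange K).a₃ = f W.a₃ := rfl
  rw [b1, Units.val_inv_eq_inv_val] at e1
  rw [b1, b2, Units.val_inv_eq_inv_val] at e2
  rw [b1, b3, Units.val_inv_eq_inv_val] at e3
  field_simp at e1 e2 e3
  -- the formulas for `a₁`, `a₂`, `a₃` of `C • W` can be solved for `s`, `r`, `t` in turn
  have hs : f (v2 * (u * I.a₁ - W.a₁)) = C.s := by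
    simp only [map_mul, map_sub, hu]
    linear_combination f v2 * e1 + C.s * hv2'
  obtain ⟨s, hs⟩ : ∃ s, f s = C.s := ⟨_, hs⟩
  have hr : f (v3 * (u ^ 2 * I.a₂ - W.a₂ + s * W.a₁ + s ^ 2)) = C.r := by
    simp only [map_mul, map_sub, map_add, map_pow, hu, hs]
    linear_combination f v3 * e2 + C.r * hv3'
  obtain ⟨r, hr⟩ : ∃ r, f r = C.r := ⟨_, hr⟩
  have ht : f (v2 * (u ^ 3 * I.a₃ - W.a₃ - r * W.a₁)) = C.t := by
    simp only [map_mul, map_sub, map_pow, hu, hr]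
    linear_combination f v2 * e3 + C.t * hv2'
  obtain ⟨t, ht⟩ : ∃ t, f t = C.t := ⟨_, ht⟩
  let D : VariableChange R := ⟨u, r, s, t⟩
  have hD : D.map f = C := by
    ext
    · exact hu
    · exact hr
    · exact hs
    · exact ht
  have hID : I = D • W := by
    apply map_injective (IsFractionRing.injective R K)
    change I.map f = (D • W).map f
    rw [hIM, ← map_variableChange, hD]
    rfl
  refine ⟨D.map (residue R), ?_⟩
  rw [map_variableChange, ← hID]
  rfl

/-- The local polynomial at a place of good reduction that does not divide `6`, in terms of the
affine points of the reduction of any equation with unit discriminant. The point at infinity cancels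
the `1` in `a = q + 1 - |W(κ)|`. -/
theorem localPolynomial_eq [Finite (ResidueField R)] (h6 : IsUnit (6 : R))
    {W : WeierstrassCurve R} (hΔ : IsUnit W.Δ) :
    (W.baseChange K).localPolynomial R =
      1 - Polynomial.C ((Nat.card (ResidueField R) : ℤ) -
        Nat.card {P : ResidueField R × ResidueField R //
          (W.map (residue R)).toAffine.Equation P.1 P.2}) * Polynomial.X +
        Polynomial.C (Nat.card (ResidueField R) : ℤ) * Polynomial.X ^ 2 := by
  have hgood := minimal_hasGoodReduction (K := K) hΔ
  rw [localPolynomial, if_pos hgood]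
  have hΔ' : (W.map (residue R)).Δ ≠ 0 := by
    rw [map_Δ]; exact (hΔ.map (residue R)).ne_zero
  have : Nat.card (((W.baseChange K).minimal R).reduction R).toAffine.Point =
      Nat.card {P : ResidueField R × ResidueField R //
        (W.map (residue R)).toAffine.Equation P.1 P.2} + 1 := by
    obtain ⟨C₀, hC₀⟩ := exists_reduction_eq_variableChange
      (C := ((W.baseChange K).exists_isMinimal R).choose)
      (hM := ((W.baseChange K).exists_isMinimal R).choose_spec) h6 hΔ hgood.goodReduction
    have e : ((W.baseChange K).minimal R).reduction R = C₀ • W.map (residue R) := hC₀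
    rw [e, card_point_eq_card_equation_add_one, Nat.card_congr (variableChangePointEquiv _ C₀)]
    rw [variableChange_Δ]
    exact mul_ne_zero (pow_ne_zero _ (Units.ne_zero _)) hΔ'
  rw [this]
  push_cast
  congr 4
  ring

end GoodReduction

end WeierstrassCurve

/-! ### Coefficients of Euler products and of `L(E, s)` -/

namespace ArithmeticFunction

lemma mul_apply_prime_pow_of_eq_zero {R : Type*} [CommSemiring R] {p : ℕ} (hp : p.Prime)
    {f g : ArithmeticFunction R} (g1 : g 1 = 1) (gp : ∀ j ≠ 0, g (p ^ j) = 0) (k : ℕ) :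
    (f * g) (p ^ k) = f (p ^ k) := by
  rw [mul_apply, Finset.sum_eq_single (p ^ k, 1), g1, mul_one]
  · rintro ⟨a, b⟩ hab hne
    obtain ⟨hab, -⟩ := Nat.mem_divisorsAntidiagonal.mp hab
    obtain ⟨j, -, rfl⟩ := (Nat.dvd_prime_pow hp).mp (Dvd.intro_left _ hab)
    dsimp only at hab ⊢
    rw [gp j, mul_zero]
    rintro rfl
    rw [pow_zero, mul_one] at hab
    exact hne (by rw [hab, pow_zero])
  · intro h
    exact absurd (by simp [hp.ne_zero]) h

lemma prod_apply_prime_pow_of_eq_zero {R ι : Type*} [CommSemiring R] {p : ℕ} (hp : p.Prime)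
    {f : ι → ArithmeticFunction R} (s : Finset ι) (f1 : ∀ i ∈ s, f i 1 = 1)
    (fp : ∀ i ∈ s, ∀ j ≠ 0, f i (p ^ j) = 0) :
    (∏ i ∈ s, f i) 1 = 1 ∧ ∀ j ≠ 0, (∏ i ∈ s, f i) (p ^ j) = 0 := by
  classical
  induction s using Finset.induction_on with
  | empty =>
    refine ⟨by simp, fun j hj ↦ ?_⟩
    rw [Finset.prod_empty, one_apply_ne]
    exact (Nat.one_lt_pow hj hp.one_lt).ne'
  | insert i s hi ih =>
    obtain ⟨h1, h2⟩ := ih (fun i hi ↦ f1 i (Finset.mem_insert_of_mem hi))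
      (fun i hi ↦ fp i (Finset.mem_insert_of_mem hi))
    rw [Finset.prod_insert hi]
    refine ⟨?_, fun j hj ↦ ?_⟩
    · rw [mul_apply_one, h1, f1 i (Finset.mem_insert_self i s), one_mul]
    · rw [mul_apply_prime_pow_of_eq_zero hp h1 h2, fp i (Finset.mem_insert_self i s) j hj]

/-- In an Euler product over distinct primes `q i`, only the factor at `q i₀` contributes to the
coefficients at the powers of `q i₀`. -/
theorem eulerProduct_ofPowerSeries_apply_prime_pow {R ι : Type*} [CommSemiring R] {q : ι → ℕ}
    (hq : ∀ i, (q i).Prime) (hinj : Function.Injective q) {f : ι → PowerSeries R}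
    (hf : ∀ i, (f i).constantCoeff = 1) (i₀ : ι) (k : ℕ) :
    eulerProduct (fun i ↦ ofPowerSeries (q i) (f i)) (q i₀ ^ k) = (f i₀).coeff k := by
  classical
  have : Northcott q := ⟨fun b ↦ (Set.finite_Iic b).preimage hinj.injOn⟩
  have h := (tendsTo_eulerProduct_ofPowerSeries q f hf (q i₀ ^ k)).and
    (Filter.eventually_ge_atTop {i₀})
  obtain ⟨s, hs, hs'⟩ := h.exists
  have hmem : i₀ ∈ s := hs' (Finset.mem_singleton_self i₀)
  rw [← hs, ← Finset.mul_prod_erase s _ hmem]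
  obtain ⟨h1, h2⟩ := prod_apply_prime_pow_of_eq_zero (hq i₀)
    (f := fun i ↦ ofPowerSeries (q i) (f i)) (s.erase i₀) (fun i _ ↦ by simp [hf]) (by
      intro i hi j hj
      rw [ofPowerSeries_apply (hq i).one_lt, Function.extend_apply', Pi.zero_apply]
      rintro ⟨m, hm⟩
      have hdvd : q i₀ ∣ q i ^ m := (dvd_pow_self _ hj).trans hm.symm.dvd
      exact Finset.ne_of_mem_erase hi
        (hinj ((Nat.prime_dvd_prime_iff_eq (hq i₀) (hq i)).mp ((hq i₀).dvd_of_dvd_pow hdvd))).symm)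
  rw [mul_apply_prime_pow_of_eq_zero (hq i₀) h1 h2, ofPowerSeries_apply_pow (hq i₀).one_lt]

end ArithmeticFunction

open Polynomial in
/-- The first coefficients of the power series `1 / (1 - aX + qX²)`. -/
lemma invOfUnit_quadratic_coeff (a q : ℤ) :
    (PowerSeries.invOfUnit ((1 - C a * X + C q * X ^ 2 : ℤ[X]) : PowerSeries ℤ) 1).coeff 1 = a ∧
    (PowerSeries.invOfUnit ((1 - C a * X + C q * X ^ 2 : ℤ[X]) : PowerSeries ℤ) 1).coeff 2 =
      a ^ 2 - q := by
  have h := PowerSeries.mul_invOfUnit ((1 - C a * X + C q * X ^ 2 : ℤ[X]) : PowerSeries ℤ) 1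
    (by simp)
  set G := PowerSeries.invOfUnit ((1 - C a * X + C q * X ^ 2 : ℤ[X]) : PowerSeries ℤ) 1
  have h0 := congrArg (PowerSeries.coeff 0) h
  have h1 := congrArg (PowerSeries.coeff 1) h
  have h2 := congrArg (PowerSeries.coeff 2) h
  have ha : (a : ℤ[X]).coeff 1 = 0 := by
    rw [← C_eq_intCast, coeff_C, if_neg one_ne_zero]
  simp [PowerSeries.coeff_mul, Finset.Nat.antidiagonal_succ, PowerSeries.coeff_one,
    PowerSeries.coeff_X, ha] at h0 h1 h2
  rw [h0] at h1 h2
  refine ⟨by linarith, ?_⟩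
  have h3 : G.coeff 1 = a := by linarith
  rw [h3] at h2
  linarith

open IsDedekindDomain Rat.HeightOneSpectrum

local instance primes_fact_prime (ℓ : Nat.Primes) : Fact ℓ.1.Prime := ⟨ℓ.2⟩

/-- The residue field of the completion of `ℚ` at a finite place `v` is `𝔽_ℓ`, for the prime `ℓ`
below `v`. -/
noncomputable def residueFieldEquivZMod (v : HeightOneSpectrum (𝓞 ℚ)) :
    IsLocalRing.ResidueField (v.adicCompletionIntegers ℚ) ≃+* ZMod (primesEquiv v).1 :=
  (IsLocalRing.ResidueField.mapEquiv
    (adicCompletionIntegers.padicIntEquiv v).toAlgEquiv.toRingEquiv).trans PadicInt.residueField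

lemma card_residueField (v : HeightOneSpectrum (𝓞 ℚ)) :
    Nat.card (IsLocalRing.ResidueField (v.adicCompletionIntegers ℚ)) = (primesEquiv v).1 := by
  rw [Nat.card_congr (residueFieldEquivZMod v).toEquiv, Nat.card_zmod]

lemma isUnit_natCast_adicCompletionIntegers (v : HeightOneSpectrum (𝓞 ℚ)) {n : ℕ}
    (hn : ¬ (primesEquiv v).1 ∣ n) : IsUnit (n : v.adicCompletionIntegers ℚ) := by
  rw [← IsLocalRing.residue_ne_zero_iff_isUnit, map_natCast]
  intro h
  have := congrArg (residueFieldEquivZMod v) h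
  rw [map_natCast, map_zero, ZMod.natCast_eq_zero_iff] at this
  exact hn this

/-- The coefficients of `L(E, s)` at `p` and `p²`, for `E : y² = x³ + 1` and `p ∤ 6`, in terms of
the number of affine points of `E` over `𝔽_p`. -/
theorem curveE_LFunction_apply {p : ℕ} [Fact p.Prime] (hp6 : ¬ p ∣ 6) :
    curveE.LFunction p = p - Nat.card {P : ZMod p × ZMod p // P.2 ^ 2 = P.1 ^ 3 + 1} ∧
    curveE.LFunction (p ^ 2) =
      (p - Nat.card {P : ZMod p × ZMod p // P.2 ^ 2 = P.1 ^ 3 + 1} : ℤ) ^ 2 - p := by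
  obtain ⟨v, hv⟩ := (primesEquiv (R := 𝓞 ℚ)).surjective ⟨p, Fact.out⟩
  have hvp : (primesEquiv v).1 = p := congrArg Subtype.val hv
  have key : ∀ k, curveE.LFunction (p ^ k) =
      ((curveE.baseChange (v.adicCompletion ℚ)).localPowerSeries
        (v.adicCompletionIntegers ℚ)).coeff k := by
    intro k
    have h := ArithmeticFunction.eulerProduct_ofPowerSeries_apply_prime_pow
      (q := fun v : HeightOneSpectrum (𝓞 ℚ) ↦
        Nat.card (IsLocalRing.ResidueField (v.adicCompletionIntegers ℚ)))
      (f := fun v ↦ (curveE.baseChange (v.adicCompletion ℚ)).localPowerSeries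
        (v.adicCompletionIntegers ℚ))
      (fun v ↦ by rw [card_residueField]; exact (primesEquiv v).2)
      (fun v w h ↦ by
        simp only [card_residueField] at h
        exact primesEquiv.injective (Subtype.ext h))
      (fun v ↦ by simp [WeierstrassCurve.localPowerSeries]) v k
    rw [card_residueField, hvp] at h
    exact h
  let W : WeierstrassCurve (v.adicCompletionIntegers ℚ) := ⟨0, 0, 0, 0, 1⟩
  have hW : curveE.baseChange (v.adicCompletion ℚ) = W.baseChange (v.adicCompletion ℚ) := by
    ext <;> simp [curveE, W, WeierstrassCurve.baseChange]
  have hp : p.Prime := Fact.out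
  have hn6 := isUnit_natCast_adicCompletionIntegers v (n := 6) (by rwa [hvp])
  -- the discriminant of `y² = x³ + 1` is `-432 = -2⁴ * 3³`
  have hn432 := isUnit_natCast_adicCompletionIntegers v (n := 432) (by
    rw [hvp]
    intro h
    have : p ∣ 6 ^ 4 := h.trans ⟨3, by norm_num⟩
    exact hp6 (hp.dvd_of_dvd_pow this))
  have hΔ : IsUnit W.Δ := by
    have : W.Δ = -((432 : ℕ) : v.adicCompletionIntegers ℚ) := by
      simp [W, WeierstrassCurve.Δ, WeierstrassCurve.b₂, WeierstrassCurve.b₄, WeierstrassCurve.b₆,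
        WeierstrassCurve.b₈]
      norm_num
    rw [this]
    exact hn432.neg
  have : Finite (IsLocalRing.ResidueField (v.adicCompletionIntegers ℚ)) :=
    Finite.of_equiv _ (residueFieldEquivZMod v).symm.toEquiv
  have hloc := WeierstrassCurve.localPolynomial_eq (K := v.adicCompletion ℚ) hn6 hΔ
  rw [card_residueField, hvp] at hloc
  subst hvp
  have hcard : Nat.card {P : IsLocalRing.ResidueField (v.adicCompletionIntegers ℚ) ×
      IsLocalRing.ResidueField (v.adicCompletionIntegers ℚ) //
        (W.map (IsLocalRing.residue _)).toAffine.Equation P.1 P.2} =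
      Nat.card {P : ZMod (primesEquiv v).1 × ZMod (primesEquiv v).1 // P.2 ^ 2 = P.1 ^ 3 + 1} := by
    refine Nat.card_congr (Equiv.subtypeEquiv
      (Equiv.prodCongr (residueFieldEquivZMod v).toEquiv (residueFieldEquivZMod v).toEquiv) ?_)
    rintro ⟨x, y⟩
    rw [WeierstrassCurve.Affine.equation_iff, ← (residueFieldEquivZMod v).injective.eq_iff]
    simp [W]
  rw [hcard] at hloc
  obtain ⟨c1, c2⟩ := invOfUnit_quadratic_coeff ((primesEquiv v).1 -
    Nat.card {P : ZMod (primesEquiv v).1 × ZMod (primesEquiv v).1 // P.2 ^ 2 = P.1 ^ 3 + 1} : ℤ)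
    (primesEquiv v).1
  refine ⟨?_, ?_⟩
  · refine (congrArg _ (pow_one _).symm).trans ((key 1).trans ?_)
    rw [hW, WeierstrassCurve.localPowerSeries, hloc, c1]
  · refine (key 2).trans ?_
    rw [hW, WeierstrassCurve.localPowerSeries, hloc, c2]

/-! ### Ideals above a split prime of a quadratic field -/

section SplitPrime

variable {K : Type*} [Field K] [NumberField K]

/-- If `p = a b` with `a` and `b` in primes `𝔭` and `𝔮` of a quadratic field, then these primes
have norm `p` and are generated by `a` and `b`. -/
lemma eq_span_of_mul_eq_prime (hK : Module.finrank ℚ K = 2) {p : ℕ} (hp : p.Prime)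
    {𝔭 𝔮 : Ideal (𝓞 K)} (h𝔭 : 𝔭 ≠ ⊤) (h𝔮 : 𝔮 ≠ ⊤) {a b : 𝓞 K} (ha : a ∈ 𝔭) (hb : b ∈ 𝔮)
    (hab : a * b = p) :
    Ideal.absNorm 𝔭 = p ∧ Ideal.absNorm 𝔮 = p ∧ 𝔭 = Ideal.span {a} ∧ 𝔮 = Ideal.span {b} := by
  have hN : Ideal.absNorm (Ideal.span {a}) * Ideal.absNorm (Ideal.span {b}) = p ^ 2 := by
    rw [← map_mul, Ideal.span_singleton_mul_span_singleton, hab, Ideal.absNorm_span_natCast,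
      NumberField.RingOfIntegers.rank, hK]
  have key : ∀ {I J : Ideal (𝓞 K)}, I ∣ J → Ideal.absNorm I = p → Ideal.absNorm J = p → I = J := by
    rintro I _ ⟨L, rfl⟩ hI hJ
    rw [map_mul, hI] at hJ
    rw [Ideal.absNorm_eq_one_iff.mp (Nat.eq_of_mul_eq_mul_left hp.pos (hJ.trans (mul_one p).symm)),
      Ideal.mul_top]
  have da : 𝔭 ∣ Ideal.span {a} := Ideal.dvd_span_singleton.mpr ha
  have db : 𝔮 ∣ Ideal.span {b} := Ideal.dvd_span_singleton.mpr hb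
  have dNa := map_dvd Ideal.absNorm da
  have dNb := map_dvd Ideal.absNorm db
  have n1 : Ideal.absNorm 𝔭 ≠ 1 := fun h ↦ h𝔭 (Ideal.absNorm_eq_one_iff.mp h)
  have n2 : Ideal.absNorm 𝔮 ≠ 1 := fun h ↦ h𝔮 (Ideal.absNorm_eq_one_iff.mp h)
  have m1 : Ideal.absNorm (Ideal.span {a}) ≠ 1 := fun h ↦ n1 (Nat.dvd_one.mp (h ▸ dNa))
  have m2 : Ideal.absNorm (Ideal.span {b}) ≠ 1 := fun h ↦ n2 (Nat.dvd_one.mp (h ▸ dNb))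
  obtain ⟨ea, eb⟩ := (Nat.Prime.mul_eq_prime_sq_iff hp m1 m2).mp hN
  have e1 : Ideal.absNorm 𝔭 = p := ((Nat.dvd_prime hp).mp (ea ▸ dNa)).resolve_left n1
  have e2 : Ideal.absNorm 𝔮 = p := ((Nat.dvd_prime hp).mp (eb ▸ dNb)).resolve_left n2
  exact ⟨e1, e2, key da e1 ea, key db e2 eb⟩

/-- The ideals of norm `p ^ k` divide `(p) ^ k = (𝔭 𝔮) ^ k`. -/
lemma absNorm_eq_prime_pow_iff {p : ℕ} (hp : p.Prime) {𝔭 𝔮 : Ideal (𝓞 K)} (h𝔭 : 𝔭.IsPrime)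
    (h𝔮 : 𝔮.IsPrime) (n𝔭 : Ideal.absNorm 𝔭 = p) (n𝔮 : Ideal.absNorm 𝔮 = p)
    (h : 𝔭 * 𝔮 = Ideal.span {(p : 𝓞 K)}) (k : ℕ) (I : Ideal (𝓞 K)) :
    Ideal.absNorm I = p ^ k ↔ ∃ i j, i + j = k ∧ I = 𝔭 ^ i * 𝔮 ^ j := by
  constructor
  · intro hI
    have b𝔭 : 𝔭 ≠ ⊥ := by rintro rfl; exact hp.ne_zero (by rw [← n𝔭, Ideal.absNorm_bot])
    have b𝔮 : 𝔮 ≠ ⊥ := by rintro rfl; exact hp.ne_zero (by rw [← n𝔮, Ideal.absNorm_bot])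
    have hd : I ∣ 𝔭 ^ k * 𝔮 ^ k := by
      rw [← mul_pow, h, Ideal.span_singleton_pow, Ideal.dvd_span_singleton]
      have := Ideal.absNorm_mem I
      rwa [hI, Nat.cast_pow] at this
    obtain ⟨A, B, hA, hB, rfl⟩ := exists_dvd_and_dvd_of_dvd_mul hd
    obtain ⟨i, -, hi⟩ := (dvd_prime_pow (Ideal.prime_of_isPrime b𝔭 h𝔭) k).mp hA
    obtain ⟨j, -, hj⟩ := (dvd_prime_pow (Ideal.prime_of_isPrime b𝔮 h𝔮) k).mp hB
    rw [associated_iff_eq] at hi hj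
    refine ⟨i, j, ?_, by rw [hi, hj]⟩
    rw [hi, hj, map_mul, map_pow, map_pow, n𝔭, n𝔮, ← pow_add] at hI
    exact Nat.pow_right_injective hp.two_le hI
  · rintro ⟨i, j, rfl, rfl⟩
    rw [map_mul, map_pow, map_pow, n𝔭, n𝔮, ← pow_add]

variable {ι : K →+* ℂ} (χ : HeckeCharacter ι)

lemma heckeCharacter_coeff_eq_sum {n : ℕ} {s : Finset (Ideal (𝓞 K))}
    (hs : ∀ I, Ideal.absNorm I = n ↔ I ∈ s) : χ.coeff n = ∑ I ∈ s, χ.toFun I := by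
  rw [HeckeCharacter.coeff, finsum_subtype_eq_finsum_cond, ← finsum_mem_coe_finset]
  simp_rw [hs, Finset.mem_coe]

/-- The coefficients of `L(χ, s)` at `p` and `p²`, for `p = 𝔭 𝔮` with `𝔭 ≠ 𝔮`. -/
theorem heckeCharacter_coeff_split {p : ℕ} (hp : p.Prime) {𝔭 𝔮 : Ideal (𝓞 K)} (h𝔭 : 𝔭.IsPrime)
    (h𝔮 : 𝔮.IsPrime) (n𝔭 : Ideal.absNorm 𝔭 = p) (n𝔮 : Ideal.absNorm 𝔮 = p)
    (h : 𝔭 * 𝔮 = Ideal.span {(p : 𝓞 K)}) (hne : 𝔭 ≠ 𝔮) :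
    χ.coeff p = χ.toFun 𝔭 + χ.toFun 𝔮 ∧
    χ.coeff (p ^ 2) = χ.toFun 𝔭 ^ 2 + χ.toFun 𝔭 * χ.toFun 𝔮 + χ.toFun 𝔮 ^ 2 := by
  classical
  have b𝔭 : 𝔭 ≠ 0 := by rintro rfl; exact hp.ne_zero (by rw [← n𝔭, map_zero])
  have b𝔮 : 𝔮 ≠ 0 := by rintro rfl; exact hp.ne_zero (by rw [← n𝔮, map_zero])
  have k := absNorm_eq_prime_pow_iff hp h𝔭 h𝔮 n𝔭 n𝔮 h
  constructor
  · rw [heckeCharacter_coeff_eq_sum χ (s := {𝔭, 𝔮}), Finset.sum_pair hne]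
    intro I
    have := k 1 I
    rw [pow_one] at this
    rw [this, Finset.mem_insert, Finset.mem_singleton]
    constructor
    · rintro ⟨i, j, hij, rfl⟩
      obtain ⟨rfl, rfl⟩ | ⟨rfl, rfl⟩ : (i = 1 ∧ j = 0) ∨ (i = 0 ∧ j = 1) := by omega
      · left; simp
      · right; simp
    · rintro (rfl | rfl)
      · exact ⟨1, 0, rfl, by simp⟩
      · exact ⟨0, 1, rfl, by simp⟩
  · have d1 : 𝔭 ^ 2 ≠ 𝔭 * 𝔮 := by
      rw [sq]; exact fun e ↦ hne (mul_left_cancel₀ b𝔭 e)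
    have d2 : 𝔭 * 𝔮 ≠ 𝔮 ^ 2 := by
      rw [sq]; exact fun e ↦ hne (mul_right_cancel₀ b𝔮 e)
    have d3 : 𝔭 ^ 2 ≠ 𝔮 ^ 2 := fun e ↦ hne (pow_left_injective two_ne_zero e)
    rw [heckeCharacter_coeff_eq_sum χ (s := {𝔭 ^ 2, 𝔭 * 𝔮, 𝔮 ^ 2}),
      Finset.sum_insert (by simp [d1, d3]), Finset.sum_pair d2, map_pow, map_pow, map_mul]
    · ring
    intro I
    rw [k 2 I, Finset.mem_insert, Finset.mem_insert, Finset.mem_singleton]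
    constructor
    · rintro ⟨i, j, hij, rfl⟩
      obtain ⟨rfl, rfl⟩ | ⟨rfl, rfl⟩ | ⟨rfl, rfl⟩ :
        (i = 2 ∧ j = 0) ∨ (i = 1 ∧ j = 1) ∨ (i = 0 ∧ j = 2) := by omega
      · left; simp
      · right; left; simp
      · right; right; simp
    · rintro (rfl | rfl | rfl)
      · exact ⟨2, 0, rfl, by simp⟩
      · exact ⟨1, 1, rfl, by simp⟩
      · exact ⟨0, 2, rfl, by simp⟩

/-- Two absolutely convergent Dirichlet series that agree on a half-plane have the same
coefficients. -/
lemma HeckeCharacter.IsAssociatedTo.coeff_eq {χ : HeckeCharacter ι} {W : WeierstrassCurve ℚ}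
    (h : χ.IsAssociatedTo W) {n : ℕ} (hn : n ≠ 0) : χ.coeff n = W.LFunction n := by
  obtain ⟨σ, h⟩ := h
  have h1 := h (σ + 1 : ℝ) (by simp)
  refine (LSeries.eq_of_LSeries_eventually_eq
    ((LSeriesSummable.abscissaOfAbsConv_le h1.1).trans_lt (EReal.coe_lt_top _))
    ((LSeriesSummable.abscissaOfAbsConv_le h1.2.1).trans_lt (EReal.coe_lt_top _)) ?_ hn).symm
  filter_upwards [Filter.eventually_gt_atTop σ] with x hx
  exact (h x (by simpa using hx)).2.2

end SplitPrime

/-! ### The Jacobi sum as a generator of `𝔭` -/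

section JacobiGenerator

variable {p : ℕ} [Fact p.Prime]

/-- `∑_u u^m (1 - u)^n = 0` in `𝔽_p` when `m + n < p - 1`. -/
lemma sum_pow_mul_one_sub_pow {m n : ℕ} (h : m + n < p - 1) :
    ∑ u : ZMod p, u ^ m * (1 - u) ^ n = 0 := by
  simp_rw [sub_eq_neg_add, add_pow, Finset.mul_sum]
  rw [Finset.sum_comm]
  refine Finset.sum_eq_zero fun i hi ↦ ?_
  have hi : i ≤ n := Nat.lt_succ_iff.mp (Finset.mem_range.mp hi)
  have : ∀ u : ZMod p, u ^ m * ((-u) ^ i * 1 ^ (n - i) * (n.choose i : ZMod p)) =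
      ((-1) ^ i * (n.choose i : ZMod p)) * u ^ (m + i) := by
    intro u
    rw [neg_pow, pow_add]; ring
  simp_rw [this]
  rw [← Finset.mul_sum, FiniteField.sum_pow_lt_card_sub_one, mul_zero]
  rw [ZMod.card]; omega

variable {K : Type*} [Field K] [NumberField K] {ι : K →+* ℂ} {𝔭 : Ideal (𝓞 K)}
  {ψ : MulChar (ZMod p) ℂ}

/-- The congruence `J(ψ², φ) ≡ ∑_u u^((p-1)/3) (1 - u)^((p-1)/2) ≡ 0 mod 𝔭`. -/
theorem IsSexticResidueCharacter.exists_mem_eq_jacobiSum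
    (hp2 : p ≠ 2) (hp𝔭 : (p : 𝓞 K) ∈ 𝔭) (hψ : IsSexticResidueCharacter ι p 𝔭 ψ) :
    ∃ π ∈ 𝔭, ι (π : K) = -jacobiSum (ψ ^ 2) (quadCharZMod p) := by
  set m := (p - 1) / 6 with hm
  have hz : ∀ n : ℤ, ∃ z : 𝓞 K, ι (z : K) = ψ (n : ZMod p) ∧ z - (n : 𝓞 K) ^ m ∈ 𝔭 :=
    fun n ↦ hψ.congr n n (by simp)
  choose z hz1 hz2 using hz
  let n : ZMod p → ℤ := fun u ↦ (u.val : ℤ)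
  have hn : ∀ u, (n u : ZMod p) = u := fun u ↦ by simp [n]
  -- `φ = ψ³`, so `J(ψ², φ)` is the image of `∑ z(u)² z(1 - u)³`
  refine ⟨-∑ u : ZMod p, z (n u) ^ 2 * z (1 - n u) ^ 3, ?_, ?_⟩
  · refine neg_mem ?_
    rw [← Ideal.Quotient.eq_zero_iff_mem, map_sum]
    have hq : ∀ k : ℤ, Ideal.Quotient.mk 𝔭 (z k) = Ideal.Quotient.mk 𝔭 ((k ^ m : ℤ) : 𝓞 K) := by
      intro k
      rw [Ideal.Quotient.mk_eq_mk_iff_sub_mem]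
      simpa using hz2 k
    have : ∀ u : ZMod p, Ideal.Quotient.mk 𝔭 (z (n u) ^ 2 * z (1 - n u) ^ 3) =
        Ideal.Quotient.mk 𝔭 ((n u ^ (m * 2) * (1 - n u) ^ (m * 3) : ℤ) : 𝓞 K) := by
      intro u
      rw [map_mul, map_pow, map_pow, hq, hq, ← map_pow, ← map_pow, ← map_mul]
      push_cast
      rw [pow_mul, pow_mul]
    simp_rw [this]
    rw [← map_sum, ← Int.cast_sum, Ideal.Quotient.eq_zero_iff_mem]
    have h0 : ((∑ u : ZMod p, n u ^ (m * 2) * (1 - n u) ^ (m * 3) : ℤ) : ZMod p) = 0 := by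
      push_cast
      simp_rw [hn]
      have h1 : 1 < p := (Fact.out : p.Prime).one_lt
      exact sum_pow_mul_one_sub_pow (by omega)
    rw [ZMod.intCast_zmod_eq_zero_iff_dvd] at h0
    obtain ⟨c, hc⟩ := h0
    rw [hc, Int.cast_mul, Int.cast_natCast]
    exact 𝔭.mul_mem_right _ hp𝔭
  · rw [quadCharZMod_eq_pow_three hp2 hψ.order, jacobiSum]
    simp only [map_neg, map_sum, map_mul, map_pow, hz1]
    congr 1
    refine Finset.sum_congr rfl fun u _ ↦ ?_
    rw [MulChar.pow_apply' ψ two_ne_zero, MulChar.pow_apply' ψ three_ne_zero]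
    push_cast
    rw [hn]

lemma star_jacobiSum (X Y : MulChar (ZMod p) ℂ) :
    (starRingEnd ℂ) (jacobiSum X Y) = jacobiSum X⁻¹ Y⁻¹ := by
  rw [jacobiSum, jacobiSum, map_sum]
  refine Finset.sum_congr rfl fun x _ ↦ ?_
  rw [map_mul, starRingEnd_apply, starRingEnd_apply, MulChar.star_apply', MulChar.star_apply']

lemma jacobiSum_mul_star (hp2 : p ≠ 2) (hψ : orderOf ψ = 6) :
    jacobiSum (ψ ^ 2) (quadCharZMod p) *
      (starRingEnd ℂ) (jacobiSum (ψ ^ 2) (quadCharZMod p)) = p := by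
  rw [star_jacobiSum, jacobiSum_mul_jacobiSum_inv, ZMod.card]
  · rw [ZMod.ringChar_zmod_n, ringChar.eq_zero]
    exact (Fact.out : p.Prime).ne_zero.symm
  · exact pow_ne_one_of_lt_orderOf two_ne_zero (by omega)
  · exact quadCharZMod_ne_one hp2
  · rw [quadCharZMod_eq_pow_three hp2 hψ, ← pow_add]
    exact pow_ne_one_of_lt_orderOf (by norm_num) (by omega)

open NumberField.IsCMField in
/-- If `𝔭` were its own conjugate, a primitive cube root of unity `ω(u)` would be congruent to its
conjugate, since it is congruent to an integer; this forces `3 ∈ 𝔭`. -/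
lemma IsSexticResidueCharacter.comap_complexConj_ne [NumberField.IsCMField K]
    (hp3 : p ≠ 3) (h𝔭 : 𝔭.IsPrime) (hp𝔭 : (p : 𝓞 K) ∈ 𝔭)
    (hψ : IsSexticResidueCharacter ι p 𝔭 ψ) :
    𝔭 ≠ 𝔭.comap (ringOfIntegersComplexConj K) := by
  intro heq
  have hω : ψ ^ 2 ≠ 1 := pow_ne_one_of_lt_orderOf two_ne_zero (by rw [hψ.order]; norm_num)
  obtain ⟨u, hu⟩ := MulChar.ne_one_iff.mp hω
  obtain ⟨z, hz1, hz2⟩ := hψ.congr ((u : ZMod p).val : ℤ) ((u : ZMod p).val : ℤ) (by simp)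
  have hzψ : ι (z : K) = ψ u := by rw [hz1]; simp
  set c := ringOfIntegersComplexConj K with hc
  have hcz : c z - (((u : ZMod p).val : ℤ) : 𝓞 K) ^ ((p - 1) / 6) ∈ 𝔭 := by
    rw [heq, Ideal.mem_comap] at hz2
    rwa [map_sub, map_pow, map_intCast] at hz2
  have hsub : z - c z ∈ 𝔭 := by
    have := 𝔭.sub_mem hz2 hcz
    rwa [sub_sub_sub_cancel_right] at this
  have inj : Function.Injective fun x : 𝓞 K ↦ ι (x : K) :=
    ι.injective.comp NumberField.RingOfIntegers.coe_injective
  have h6 : ψ u ^ 6 = 1 := by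
    rw [← MulChar.pow_apply_coe, ← hψ.order, pow_orderOf_eq_one, MulChar.one_apply_coe]
  have hmul : z * c z = 1 := by
    apply inj
    simp only [map_mul, coe_ringOfIntegersComplexConj, hc, complexEmbedding_complexConj, hzψ,
      map_one]
    rw [starRingEnd_apply, MulChar.star_apply', mul_inv_apply_of_ne_zero _ u.ne_zero]
  have hcyc : (z ^ 2) ^ 2 + z ^ 2 + 1 = 0 := by
    have h1 : z ^ 2 - 1 ≠ 0 := by
      intro h
      apply hu
      have := congrArg (fun x : 𝓞 K ↦ ι (x : K)) h
      simp only [map_sub, map_pow, map_one, map_zero, hzψ] at this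
      rw [MulChar.pow_apply_coe]
      exact sub_eq_zero.mp this
    apply mul_left_cancel₀ h1
    apply inj
    simp only [map_mul, map_sub, map_add, map_pow, map_one, map_zero, hzψ]
    linear_combination h6
  have h1 : z ^ 2 - 1 ∈ 𝔭 := by
    have := 𝔭.mul_mem_left z hsub
    rwa [mul_sub, hmul, ← sq] at this
  have h3 : (3 : 𝓞 K) ∈ 𝔭 := by
    have := 𝔭.mul_mem_left (-(z ^ 2 + 2)) h1
    have e : -(z ^ 2 + 2) * (z ^ 2 - 1) = 3 := by linear_combination -hcyc
    rwa [e] at this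
  have hcop : Nat.Coprime p 3 := (Nat.coprime_primes Fact.out Nat.prime_three).mpr hp3
  have hbez : (p : ℤ) * p.gcdA 3 + (3 : ℕ) * p.gcdB 3 = 1 := by
    rw [← Nat.gcd_eq_gcd_ab, hcop.gcd_eq_one, Nat.cast_one]
  apply h𝔭.ne_top
  rw [Ideal.eq_top_iff_one]
  have := congrArg (fun x : ℤ ↦ (x : 𝓞 K)) hbez
  push_cast at this
  rw [← this]
  exact 𝔭.add_mem (𝔭.mul_mem_right _ hp𝔭) (𝔭.mul_mem_right _ h3)

/-- The Hecke character of `y² = x³ + 1` takes the value `-J(ψ², φ)` at `𝔭`. -/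
theorem HeckeCharacter.apply_eq_neg_jacobiSum [IsCyclotomicExtension {6} ℚ K]
    (hp : p ≡ 1 [MOD 6]) (h𝔭 : 𝔭.IsPrime) (hp𝔭 : (p : 𝓞 K) ∈ 𝔭)
    (hψ : IsSexticResidueCharacter ι p 𝔭 ψ) {χ : HeckeCharacter ι}
    (hχE : χ.IsAssociatedTo curveE) (hχ : χ.ValuesInPrimes) :
    χ.toFun 𝔭 = -jacobiSum (ψ ^ 2) (quadCharZMod p) := by
  have hpp : p.Prime := Fact.out
  have hp' : p % 6 = 1 := hp
  have hp2 : p ≠ 2 := by rintro rfl; norm_num at hp'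
  have hp3 : p ≠ 3 := by rintro rfl; norm_num at hp'
  have hp6 : ¬ p ∣ 6 := by
    intro h
    have := Nat.le_of_dvd (by norm_num) h
    have := hpp.two_le
    omega
  have : NumberField.IsCMField K :=
    IsCyclotomicExtension.Rat.isCMField K (S := {6}) ⟨6, rfl, by norm_num⟩
  have hK : Module.finrank ℚ K = 2 := by
    rw [IsCyclotomicExtension.finrank (n := 6) K
      (Polynomial.cyclotomic.irreducible_rat (by norm_num))]
    rfl
  set c := NumberField.IsCMField.ringOfIntegersComplexConj K with hc
  have inj : Function.Injective fun x : 𝓞 K ↦ ι (x : K) :=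
    ι.injective.comp NumberField.RingOfIntegers.coe_injective
  obtain ⟨π, hπ, hπJ⟩ := hψ.exists_mem_eq_jacobiSum hp2 hp𝔭
  set J := jacobiSum (ψ ^ 2) (quadCharZMod p) with hJ
  have hcπJ : ι (c π : 𝓞 K) = -(starRingEnd ℂ) J := by
    rw [hc, NumberField.IsCMField.coe_ringOfIntegersComplexConj,
      NumberField.IsCMField.complexEmbedding_complexConj, hπJ, map_neg]
  have hcc : c (c π) = π := by
    apply NumberField.RingOfIntegers.ext
    rw [hc, NumberField.IsCMField.coe_ringOfIntegersComplexConj,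
      NumberField.IsCMField.coe_ringOfIntegersComplexConj,
      NumberField.IsCMField.complexConj_apply_apply]
  set 𝔮 := 𝔭.comap c with h𝔮def
  have h𝔮 : 𝔮.IsPrime := Ideal.comap_isPrime c 𝔭
  have hπ𝔮 : c π ∈ 𝔮 := by rw [h𝔮def, Ideal.mem_comap, hcc]; exact hπ
  have hJJ := jacobiSum_mul_star hp2 hψ.order
  rw [← hJ] at hJJ
  have hππ : π * c π = p := by
    apply inj
    simp only [map_mul, hπJ, hcπJ, map_natCast]
    linear_combination hJJ
  have hne : 𝔭 ≠ 𝔮 := hψ.comap_complexConj_ne hp3 h𝔭 hp𝔭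
  obtain ⟨n𝔭, n𝔮, e𝔭, e𝔮⟩ := eq_span_of_mul_eq_prime hK hpp h𝔭.ne_top h𝔮.ne_top hπ hπ𝔮 hππ
  have hprod : 𝔭 * 𝔮 = Ideal.span {(p : 𝓞 K)} := by
    rw [e𝔭, e𝔮, Ideal.span_singleton_mul_span_singleton, hππ]
  obtain ⟨c1, c2⟩ := heckeCharacter_coeff_split χ hpp h𝔭 h𝔮 n𝔭 n𝔮 hprod hne
  obtain ⟨l1, l2⟩ := curveE_LFunction_apply hp6
  rw [hχE.coeff_eq hpp.ne_zero, l1] at c1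
  rw [hχE.coeff_eq (pow_ne_zero 2 hpp.ne_zero), l2] at c2
  have hω : orderOf (ψ ^ 2) = 3 := by
    rw [orderOf_pow' ψ two_ne_zero, hψ.order]; rfl
  have hJ2 : jacobiSum ((ψ ^ 2) ^ 2) (quadCharZMod p) = (starRingEnd ℂ) J := by
    rw [hJ, star_jacobiSum, quadCharZMod_inv]
    congr 1
    rw [eq_inv_iff_mul_eq_one, ← pow_succ]
    exact orderOf_dvd_iff_pow_eq_one.mp (by rw [hω])
  have hcount := card_points_eq_add_jacobiSum hp2 hω
  rw [hJ2] at hcount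
  push_cast at c1 c2
  rw [hcount] at c1 c2
  -- `χ(𝔭)` is a root of `X² - a_p X + p = (X + J)(X + J̄)`
  have hroot : (χ.toFun 𝔭 + J) * (χ.toFun 𝔭 + (starRingEnd ℂ) J) = 0 := by
    have h1 : χ.toFun 𝔮 = -(J + (starRingEnd ℂ) J) - χ.toFun 𝔭 := by linear_combination -c1
    rw [h1] at c2
    linear_combination -c2 + hJJ
  rcases mul_eq_zero.mp hroot with h | h
  · exact eq_neg_of_add_eq_zero_left h
  · -- here `χ(𝔭)` would be `π̄`, which generates `𝔮 ≠ 𝔭`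
    exfalso
    have h𝔭0 : 𝔭 ≠ ⊥ := by rintro rfl; exact hpp.ne_zero (by rw [← n𝔭, Ideal.absNorm_bot])
    obtain ⟨z, hz, hzχ⟩ := hχ 𝔭 h𝔭 h𝔭0
    have hzc : z = c π := inj (by
      dsimp only
      rw [hzχ, hcπJ]
      exact eq_neg_of_add_eq_zero_left h)
    have hle : 𝔮 ≤ 𝔭 := by
      rw [e𝔮, Ideal.span_singleton_le_iff_mem, ← hzc]; exact hz
    have h𝔮0 : 𝔮 ≠ ⊥ := by
      intro h; exact hpp.ne_zero (by rw [← n𝔮, h, Ideal.absNorm_bot])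
    exact hne ((h𝔮.isMaximal h𝔮0).eq_of_le h𝔭.ne_top hle).symm

end JacobiGenerator

theorem theorem2p5 {K : Type*} [Field K] [NumberField K] [IsCyclotomicExtension {6} ℚ K]
    (ι : K →+* ℂ) (p : ℕ) [Fact p.Prime] (hp : p ≡ 1 [MOD 6])
    (𝔭 : Ideal (𝓞 K)) (h𝔭 : 𝔭.IsPrime) (hp𝔭 : (p : 𝓞 K) ∈ 𝔭)
    (ψ : MulChar (ZMod p) ℂ) (hψ : IsSexticResidueCharacter ι p 𝔭 ψ)
    (χ : HeckeCharacter ι) (hχE : χ.IsAssociatedTo curveE) (hχ : χ.ValuesInPrimes)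
    (a : ZMod p) :
    ((¬ ∃ b : ZMod p, b ≠ 0 ∧ a = b ^ 2) →
      hypergeometric₂F₁ (quadCharZMod p * ψ ^ 2) (ψ ^ 2) (quadCharZMod p) a = 0 ∧
      hypergeometric₂F₁ (quadCharZMod p * ψ) ψ (quadCharZMod p) a = 0) ∧
    (∀ b : ZMod p, b ≠ 0 → a = b ^ 2 →
      hypergeometric₂F₁ (quadCharZMod p * ψ ^ 2) (ψ ^ 2) (quadCharZMod p) a =
        -(quadCharZMod p (-1) / (p : ℂ)) *
          ((ψ ^ 2) (1 + b) + (ψ ^ 2) (1 - b)) * χ.toFun 𝔭 ∧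
      hypergeometric₂F₁ (quadCharZMod p * ψ) ψ (quadCharZMod p) a =
        -(1 / (p : ℂ)) *
          ((ψ⁻¹ ^ 2) (1 + b) + (ψ⁻¹ ^ 2) (1 - b)) * χ.toFun 𝔭) := by
  have hp' : p % 6 = 1 := hp
  have hp2 : p ≠ 2 := by rintro rfl; norm_num at hp'
  have hψ2 : ψ ^ 2 ≠ 1 := pow_ne_one_of_lt_orderOf two_ne_zero (by rw [hψ.order]; norm_num)
  have hψ4 : (ψ ^ 2) ^ 2 ≠ 1 := by
    rw [← pow_mul]
    exact pow_ne_one_of_lt_orderOf (by norm_num) (by rw [hψ.order]; norm_num)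
  refine ⟨fun ha ↦ ⟨hypergeometric₂F₁_quadChar_eq_zero hp2 hψ4 ha,
    hypergeometric₂F₁_quadChar_eq_zero hp2 hψ2 ha⟩, ?_⟩
  rintro b hb rfl
  rw [HeckeCharacter.apply_eq_neg_jacobiSum hp h𝔭 hp𝔭 hψ hχE hχ,
    hypergeometric₂F₁_sextic_sq hp2 hψ.order hb, hypergeometric₂F₁_sextic hp2 hψ.order hb]
  constructor <;> ring
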